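/- Let $V$ be a universe of sets, i.e. any model of ZFC. A \emph{transitive class model} in $V$ is a class $M=\{x:\psi(x,p)\}$, definable in $V$ by an $\in$-formula $\psi$ from a parameter $p\in V$, that is transitive, contains all ordinals of $V$, and satisfies $(M,\in)\models\mathrm{ZFC}$. For an $\in$-sentence $\varphi$ and an $\in$-formula $\psi(x,y)$ let $\mathrm{TM}_\psi(\varphi,y)$ be the $\in$-formula stating that the class $\{x:\psi(x,y)\}$ is transitive, almost universal (every set that is a subset of it is a subset of one of its elements), closed under the Gödel operations, contains all ordinals, and satisfies (by relativization) the axiom of choice and $\varphi$. The sentence $\varphi$ is a \emph{uniqueness statement} if, for all $\psi,\psi'$, ZFC proves $$\forall y,y'\,\bigl[(\mathrm{TM}_\psi(\varphi,y)\wedge \mathrm{TM}_{\psi'}(\varphi,y'))\rightarrow\forall x\,(\psi(x,y)\leftrightarrow\psi'(x,y'))\bigr].$$ For a theory $T\supseteq\mathrm{ZFC}$ in the language $\{\in\}$, $\varphi$ is a \emph{$T$-canonical statement} if it is a uniqueness statement and for some $\psi$ the theory $T$ proves $\exists y\,\mathrm{TM}_\psi(\varphi,y)$. A transitive class model $M$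 in $V$ is \emph{$T$-canonical} if $M\models\varphi$ for some $T$-canonical statement $\varphi$. A sentence is \emph{canonically necessary} (with respect to $T$) if it holds in all $T$-canonical models, in every universe $V\models\mathrm{ZFC}$. \textbf{Theorem.} (1) For every theory $T\supseteq\mathrm{ZFC}$, the statement ``there is no measurable cardinal'' is canonically necessary with respect to $T$. (2) Let $V\models\mathrm{ZFC}$, let $M$ be a transitive class model in $V$, and let $\kappa,U\in M$ be such that $M\models$ ``$\kappa$ is an uncountable cardinal and $U$ is a nonprincipal $\kappa$-complete ultrafilter on $\kappa$'' (for instance, a normal ultrafilter on $\kappa$). Then there is a transitive class model $N$ in $V$ which is (the transitive collapse of) the ultrapower $\mathrm{Ult}(M,U)$ formed from the functions on $\kappa$ lying in $M$, such that $N\neq M$ and $N$ satisfies exactly the same $\in$-sentences as $M$; in particular $N$ satisfies every sentence $\varphi$ with $M\models\varphi$. -/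

import Mathlib

universe u

open FirstOrder FirstOrder.Language

namespace CanonicalTruth

/-! ### The language of set theory and a readable way to write its formulas -/

/-- The only non-logical symbol of set theory: the binary relation symbol `∈`. -/
inductive SetRel : ℕ → Type
  | mem : SetRel 2

/-- The first-order language of set theory. -/
def LSet : Language := ⟨fun _ => Empty, SetRel⟩

instance : LSet.IsRelational := fun _ => inferInstanceAs (IsEmpty Empty)

/-- Formulas of set theory with free variables from `α` and `n` further variables. -/
abbrev Fm (α : Type) (n : ℕ) := LSet.BoundedFormula α n

/-- The variables that may occur in a formula of type `Fm α n`. -/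
abbrev Var (α : Type) (n : ℕ) := α ⊕ Fin n

section Formulas

variable {α β : Type} {n : ℕ}

/-- A variable, seen from below one more quantifier. -/
def up (x : Var α n) : Var α (n + 1) := Sum.map id Fin.castSucc x

instance : Coe (Var α n) (Var α (n + 1)) := ⟨up⟩

/-- The variable bound by the innermost quantifier. -/
def new : Var α (n + 1) := Sum.inr (Fin.last n)

/-- The free variable with name `a`. -/
def fv (a : α) : Var α n := Sum.inl a

def memF (x y : Var α n) : Fm α n :=
  Relations.boundedFormula₂ (L := LSet) SetRel.mem (Term.var x) (Term.var y)

def eqF (x y : Var α n) : Fm α n := Term.bdEqual (Term.var x) (Term.var y)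

/-- Universal quantification; the bound variable is passed to `f`. -/
def allF (f : Var α (n + 1) → Fm α (n + 1)) : Fm α n := (f new).all

/-- Existential quantification; the bound variable is passed to `f`. -/
def exF (f : Var α (n + 1) → Fm α (n + 1)) : Fm α n := (f new).ex

/-- `∀ z ∈ x, …` -/
def allIn (x : Var α n) (f : Var α (n + 1) → Fm α (n + 1)) : Fm α n :=
  allF fun z => memF z x ⟹ f z

/-- `∃ z ∈ x, …` -/
def exIn (x : Var α n) (f : Var α (n + 1) → Fm α (n + 1)) : Fm α n :=
  exF fun z => memF z x ⊓ f z

/-- The formula obtained from `ψ` by substituting variables for its free variables. -/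
def inst (ψ : LSet.Formula β) (σ : β → Var α n) : Fm α n := BoundedFormula.relabel (k := 0) σ ψ

/-- Universal closure of a formula with finitely many free variables. -/
def univClosure {k : ℕ} (ψ : LSet.Formula (Fin k)) : LSet.Sentence :=
  BoundedFormula.alls (inst (α := Empty) (n := k) ψ Sum.inr)

/-! ### Basic set-theoretic notions as formulas -/

/-- `x ⊆ y` -/
def subF (x y : Var α n) : Fm α n := allIn x fun z => memF z y

/-- `x = ∅` -/
def emptyF (x : Var α n) : Fm α n := allF fun z => ∼(memF z x)

/-- `z = {x, y}` -/
def pairF (z x y : Var α n) : Fm α n := allF fun w => memF w z ⇔ (eqF w x ⊔ eqF w y)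

/-- `z = (x, y) = {{x}, {x, y}}` -/
def opairF (z x y : Var α n) : Fm α n :=
  exF fun a => exF fun b => pairF a x x ⊓ pairF b x y ⊓ pairF z a b

/-- `z = (x, y, w) = ((x, y), w)` -/
def tripleF (z x y w : Var α n) : Fm α n := exF fun p => opairF p x y ⊓ opairF z p w

/-- `(x, y) ∈ f` -/
def appF (f x y : Var α n) : Fm α n := exIn f fun p => opairF p x y

/-- `f` is a function with domain `d`. -/
def funF (f d : Var α n) : Fm α n :=
  (allIn f fun p => exIn d fun x => exF fun y => opairF p x y) ⊓
  (allIn d fun x => exF fun y => appF f x y ⊓ allF fun y' => appF f x y' ⟹ eqF y' y)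

/-- `x` is an ordinal: a transitive set of transitive sets. -/
def ordF (x : Var α n) : Fm α n :=
  (allIn x fun y => subF y x) ⊓ (allIn x fun y => allIn y fun z => subF z y)

/-- `w` is a nonzero limit ordinal. -/
def limF (w : Var α n) : Fm α n :=
  ordF w ⊓ (exF fun x => memF x w) ⊓ (allIn w fun x => exIn w fun y => memF x y)

/-- `k` is a cardinal: an ordinal that is not the image of a smaller ordinal. -/
def cardF (k : Var α n) : Fm α n :=
  ordF k ⊓ allIn k fun c =>
    ∼(exF fun f => funF f c ⊓ allIn k fun y => exIn c fun x => appF f x y)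

/-- `k` is an uncountable cardinal, i.e. a cardinal with a limit ordinal below it. -/
def uncountableCardF (k : Var α n) : Fm α n := cardF k ⊓ exIn k fun w => limF w

/-- `u` is an ultrafilter on the set `k`. -/
def ultrafilterF (u k : Var α n) : Fm α n :=
  (allIn u fun x => subF x k) ⊓
  memF k u ⊓
  (allIn u fun x => ∼(emptyF x)) ⊓
  (allIn u fun x => allF fun y => (subF x y ⊓ subF y k) ⟹ memF y u) ⊓
  (allIn u fun x => allIn u fun y => exIn u fun z =>
    allF fun t => memF t z ⇔ (memF t x ⊓ memF t y)) ⊓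
  (allF fun x => subF x k ⟹
    (memF x u ⊔ exIn u fun y => allF fun t => memF t y ⇔ (memF t k ⊓ ∼(memF t x))))

/-- No singleton belongs to `u`. -/
def nonprincipalF (u : Var α n) : Fm α n :=
  allIn u fun x => ∼(exF fun t => pairF x t t)

/-- `u`, a family of subsets of the cardinal `k`, is closed under intersections of families
indexed by ordinals `c < k`. -/
def completeF (u k : Var α n) : Fm α n :=
  allIn k fun c => allF fun f =>
    (funF f c ⊓ allIn c fun i => exIn u fun x => appF f i x) ⟹
      exIn u fun b => allF fun t =>
        memF t b ⇔ (memF t k ⊓ allIn c fun i => allF fun x => appF f i x ⟹ memF t x)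

/-- `u` is a nonprincipal `k`-complete ultrafilter on the uncountable cardinal `k`. -/
def measureF (k u : Var α n) : Fm α n :=
  uncountableCardF k ⊓ ultrafilterF u k ⊓ nonprincipalF u ⊓ completeF u k

/-- `k` is a measurable cardinal. -/
def measurableF (k : Var α n) : Fm α n := exF fun u => measureF k u

end Formulas

/-- The sentence "there is no measurable cardinal". -/
def noMeasurable : LSet.Sentence := ∼(exF fun k => measurableF k)

/-! ### The axioms of ZFC -/

def extensionality : LSet.Sentence :=
  allF fun x => allF fun y => (allF fun z => memF z x ⇔ memF z y) ⟹ eqF x y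

def foundation : LSet.Sentence :=
  allF fun x => (exF fun y => memF y x) ⟹ exIn x fun y => allIn x fun z => ∼(memF z y)

def pairing : LSet.Sentence :=
  allF fun x => allF fun y => exF fun z => pairF z x y

def unionAx : LSet.Sentence :=
  allF fun x => exF fun y => allF fun z => memF z y ⇔ exIn x fun t => memF z t

def powerset : LSet.Sentence :=
  allF fun x => exF fun y => allF fun z => memF z y ⇔ subF z x

def infinity : LSet.Sentence :=
  exF fun w => (exIn w fun e => emptyF e) ⊓
    allIn w fun x => exIn w fun y => allF fun z => memF z y ⇔ (memF z x ⊔ eqF z x)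

/-- Separation for the formula `ψ(p₁, …, pₖ, z)`. -/
def separation (k : ℕ) (ψ : LSet.Formula (Fin k ⊕ Fin 1)) : LSet.Sentence :=
  univClosure (k := k) <|
    allF fun a => exF fun b => allF fun z =>
      memF z b ⇔ (memF z a ⊓ inst ψ (Sum.elim fv ![z]))

/-- Replacement for the formula `ψ(p₁, …, pₖ, x, y)`. -/
def replacement (k : ℕ) (ψ : LSet.Formula (Fin k ⊕ Fin 2)) : LSet.Sentence :=
  univClosure (k := k) <|
    allF fun a =>
      (allIn a fun x => allF fun y => allF fun y' =>
        (inst ψ (Sum.elim fv ![(x : Var (Fin k) _), (y : Var (Fin k) _)]) ⊓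
          inst ψ (Sum.elim fv ![(x : Var (Fin k) _), (y' : Var (Fin k) _)])) ⟹ eqF y y') ⟹
      exF fun b => allF fun y =>
        memF y b ⇔ exIn a fun x => inst ψ (Sum.elim fv ![(x : Var (Fin k) _), (y : Var (Fin k) _)])

/-- Every set of nonempty, pairwise disjoint sets has a transversal. -/
def choice : LSet.Sentence :=
  allF fun x =>
    ((allIn x fun y => ∼(emptyF y)) ⊓
      (allIn x fun y => allIn x fun y' => (exF fun z => memF z y ⊓ memF z y') ⟹ eqF y y')) ⟹
    exF fun c => allIn x fun y => exF fun z => allF fun t =>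
      (memF t y ⊓ memF t c) ⇔ eqF t z

/-- Zermelo–Fraenkel set theory with the axiom of choice. -/
def ZFC : LSet.Theory :=
  {extensionality, foundation, pairing, unionAx, powerset, infinity, choice} ∪
    {σ | ∃ k ψ, σ = separation k ψ} ∪ {σ | ∃ k ψ, σ = replacement k ψ}

/-! ### Definable classes and transitive class models, syntactically

A formula `ψ : LSet.Formula (Fin 2)` is read as `ψ(x, y)`, with `x` the variable `0` and `y` the
variable `1`; it defines the class `{x | ψ(x, y)}` from the parameter `y`. Formulas in one free
variable `Fin 1` are statements about this parameter. -/

section ClassModels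

variable {n : ℕ}

/-- `x` belongs to the class `{x | ψ(x, y)}`, where `y` is the free variable. -/
def inClass (ψ : LSet.Formula (Fin 2)) (x : Var (Fin 1) n) : Fm (Fin 1) n :=
  inst ψ ![x, fv 0]

/-- The relativization of a formula to the class `{x | ψ(x, y)}`. -/
def relativize (ψ : LSet.Formula (Fin 2)) : {n : ℕ} → Fm Empty n → Fm (Fin 1) n
  | _, .falsum => .falsum
  | _, .equal s t =>
      .equal (s.relabel (Sum.map Empty.elim id)) (t.relabel (Sum.map Empty.elim id))
  | _, .rel R ts => .rel R fun i => (ts i).relabel (Sum.map Empty.elim id)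
  | _, .imp φ χ => .imp (relativize ψ φ) (relativize ψ χ)
  | _, .all φ => .all (inClass ψ new ⟹ relativize ψ φ)

def transClass (ψ : LSet.Formula (Fin 2)) : LSet.Formula (Fin 1) :=
  allF (n := 0) fun x => inClass ψ x ⟹ allIn x fun z => inClass ψ z

/-- Every set that is a subset of the class is a subset of some element of the class. -/
def almostUniversal (ψ : LSet.Formula (Fin 2)) : LSet.Formula (Fin 1) :=
  allF (n := 0) fun x => (allIn x fun z => inClass ψ z) ⟹ exF fun y => inClass ψ y ⊓ subF x y

def containsOrdinals (ψ : LSet.Formula (Fin 2)) : LSet.Formula (Fin 1) :=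
  allF (n := 0) fun x => ordF x ⟹ inClass ψ x

/-- If `a, b` belong to the class, so does the set `{w | Γ(w, a, b)}`. -/
def closedUnder (ψ : LSet.Formula (Fin 2))
    (Γ : {n : ℕ} → Var (Fin 1) n → Var (Fin 1) n → Var (Fin 1) n → Fm (Fin 1) n) :
    LSet.Formula (Fin 1) :=
  allF (n := 0) fun a => allF fun b => (inClass ψ a ⊓ inClass ψ b) ⟹
    exF fun c => inClass ψ c ⊓ allF fun w => memF w c ⇔ Γ w a b

/-- Closure under the ten Gödel operations `{a, b}`, `a × b`, `{(u, v) ∈ a × b | u ∈ v}`, `a \ b`,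
`a ∩ b`, `⋃ a`, `dom a`, `{(u, v) | (v, u) ∈ a}`, `{(u, v, t) | (u, t, v) ∈ a}`,
`{(u, v, t) | (v, t, u) ∈ a}`. -/
def goedelClosed (ψ : LSet.Formula (Fin 2)) : LSet.Formula (Fin 1) :=
  closedUnder ψ (fun w a b => eqF w a ⊔ eqF w b) ⊓
  closedUnder ψ (fun w a b => exIn a fun u => exIn b fun v => opairF w u v) ⊓
  closedUnder ψ (fun w a b => exIn a fun u => exIn b fun v => memF u v ⊓ opairF w u v) ⊓
  closedUnder ψ (fun w a b => memF w a ⊓ ∼(memF w b)) ⊓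
  closedUnder ψ (fun w a b => memF w a ⊓ memF w b) ⊓
  closedUnder ψ (fun w a _ => exIn a fun u => memF w u) ⊓
  closedUnder ψ (fun w a _ => exF fun v => appF a w v) ⊓
  closedUnder ψ (fun w a _ => exF fun u => exF fun v => opairF w u v ⊓ appF a v u) ⊓
  closedUnder ψ (fun w a _ => exF fun u => exF fun v => exF fun t =>
    tripleF w u v t ⊓ exIn a fun p => tripleF p u t v) ⊓
  closedUnder ψ (fun w a _ => exF fun u => exF fun v => exF fun t =>
    tripleF w u v t ⊓ exIn a fun p => tripleF p v t u)

/-- `TM(φ, y)`: the class `{x | ψ(x, y)}` is transitive, almost universal, closed under the Gödel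
operations, contains all ordinals, and satisfies the axiom of choice and `φ`. -/
def TM (ψ : LSet.Formula (Fin 2)) (φ : LSet.Sentence) : LSet.Formula (Fin 1) :=
  transClass ψ ⊓ almostUniversal ψ ⊓ goedelClosed ψ ⊓ containsOrdinals ψ ⊓
    relativize ψ choice ⊓ relativize ψ φ

/-- For all `y, y'`, if `{x | ψ(x, y)}` and `{x | ψ'(x, y')}` are transitive class models
satisfying `φ`, then they are equal. -/
def uniquenessSentence (φ : LSet.Sentence) (ψ ψ' : LSet.Formula (Fin 2)) : LSet.Sentence :=
  allF fun y => allF fun y' =>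
    (inst (TM ψ φ) ![(y : Var Empty _)] ⊓ inst (TM ψ' φ) ![(y' : Var Empty _)]) ⟹
      allF fun x => inst ψ ![(x : Var Empty _), (y : Var Empty _)] ⇔
        inst ψ' ![(x : Var Empty _), (y' : Var Empty _)]

end ClassModels

/-! ### Canonical statements, canonical models, canonical necessity

`T ⊨ᵇ σ` is Mathlib's consequence relation, i.e. (completeness theorem) provability from `T`. -/

/-- ZFC proves all uniqueness sentences of `φ`. -/
def IsUniquenessStatement (φ : LSet.Sentence) : Prop :=
  ∀ ψ ψ' : LSet.Formula (Fin 2), ZFC ⊨ᵇ uniquenessSentence φ ψ ψ'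

/-- `φ` is a uniqueness statement, and for some `ψ` the theory `T` proves that there is a `y` such
that `{x | ψ(x, y)}` is a transitive class model satisfying `φ`. -/
def IsCanonicalStatement (T : LSet.Theory) (φ : LSet.Sentence) : Prop :=
  IsUniquenessStatement φ ∧
    ∃ ψ : LSet.Formula (Fin 2), T ⊨ᵇ (exF fun y => inst (TM ψ φ) ![y] : LSet.Sentence)


section Models

variable {V : Type u} [LSet.Structure V]

/-- `M` is a transitive class model of ZFC in the universe `V`: a subclass of `V`, definable in `V`
from a parameter, transitive, containing all ordinals of `V`, and such that `(M, ∈)` is a model of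
ZFC. As `LSet` has no function symbols, a substructure is just a subclass with the induced `∈`. -/
structure IsTransitiveClassModel (M : LSet.Substructure V) : Prop where
  definable : ∃ (ψ : LSet.Formula (Fin 2)) (p : V), ∀ x : V, x ∈ M ↔ ψ.Realize ![x, p]
  transitive : ∀ x ∈ M, ∀ z : V, Structure.RelMap (L := LSet) SetRel.mem ![z, x] → z ∈ M
  ordinals : ∀ x : V, Formula.Realize (ordF (fv 0) : LSet.Formula (Fin 1)) ![x] → x ∈ M
  models : M ⊨ ZFC

/-- `M` is a `T`-canonical model in the universe `V`. -/
def IsCanonicalModel (T : LSet.Theory) (M : LSet.Substructure V) : Prop :=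
  IsTransitiveClassModel M ∧ ∃ φ : LSet.Sentence, IsCanonicalStatement T φ ∧ M ⊨ φ

/-- `M ⊨ "u is a nonprincipal k-complete ultrafilter on the uncountable cardinal k"`. -/
def IsMeasureIn (M : LSet.Substructure V) (k u : M) : Prop :=
  Formula.Realize (measureF (fv 0) (fv 1) : LSet.Formula (Fin 2)) ![k, u]

/-- The functions with domain `k` in the sense of `M`. -/
def FunctionsOn (M : LSet.Substructure V) (k : M) : Type u :=
  {f : M // Formula.Realize (funF (fv 0) (fv 1) : LSet.Formula (Fin 2)) ![f, k]}

/-- `{i ∈ k | f(i) = g(i)} ∈ u`, in the sense of `M`. -/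
def EqMod (M : LSet.Substructure V) (k u : M) (f g : FunctionsOn M k) : Prop :=
  Formula.Realize (exIn (fv 1) fun a => allF fun i => memF i a ⇔
      (memF i (fv 0) ⊓ exF fun x => appF (fv 2) i x ⊓ appF (fv 3) i x) :
    LSet.Formula (Fin 4)) ![k, u, f.1, g.1]

/-- `{i ∈ k | f(i) ∈ g(i)} ∈ u`, in the sense of `M`. -/
def MemMod (M : LSet.Substructure V) (k u : M) (f g : FunctionsOn M k) : Prop :=
  Formula.Realize (exIn (fv 1) fun a => allF fun i => memF i a ⇔
      (memF i (fv 0) ⊓ exF fun x => exF fun y => appF (fv 2) i x ⊓ appF (fv 3) i y ⊓ memF x y) :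
    LSet.Formula (Fin 4)) ![k, u, f.1, g.1]

/-- `(N, ∈)` is isomorphic, via `[f] ↦ π f`, to the ultrapower of `M` by `u` formed from the
functions in `M`. For transitive `N` this says `N = Ult(M, u)`, the transitive collapse of the
ultrapower. -/
def IsUltrapower (M : LSet.Substructure V) (k u : M) (N : LSet.Substructure V) : Prop :=
  ∃ π : FunctionsOn M k → V, Set.range π = (N : Set V) ∧
    ∀ f g, (π f = π g ↔ EqMod M k u f g) ∧
      (Structure.RelMap (L := LSet) SetRel.mem ![π f, π g] ↔ MemMod M k u f g)

end Models

/-- `σ` holds in all `T`-canonical models, over every universe `V` of ZFC. -/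
def CanonicallyNecessary (T : LSet.Theory) (σ : LSet.Sentence) : Prop :=
  ∀ (V : Type u) [LSet.Structure V], V ⊨ ZFC →
    ∀ M : LSet.Substructure V, IsCanonicalModel T M → M ⊨ σ

end CanonicalTruth

/-! Both parts rest on the ultrapower of M by U, carried out inside M, which is itself a model of
ZFC. Functions on κ in M are compared modulo U. The resulting membership relation is well-founded: a
set of functions without a minimal element yields functions f_n, for n in a limit ordinal w < κ,
with f_{n+1}(i) ∈ f_n(i) for U-almost all i; by κ-completeness a single i serves all n ∈ w, against
foundation (`hasInduction_ultMem`). Restricting membership to suitable representatives makes it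
set-like, so the Mostowski collapse `coll` exists by recursion, and N is its range. Łoś's theorem
(`los`) uses choice functions in M and shows that N and M satisfy the same sentences. N is
transitive because it is a collapse, and it contains every ordinal a because a ≤ j(a) for the
canonical embedding j = `emb`.

The point of substance is N ≠ M (`exists_forall_coll_ne`). If some measure in M had all of M as its
collapsed ultrapower, there would be a least k carrying such a measure, and being this k is
expressible in M without parameters. Łoś's theorem for that measure gives the same property to j(k)
in the ultrapower, which is M again, so j(k) = k. But the class of the identity lies in j(k) and
includes k, so j(k) ≠ k (`emb_ne`).

Part (1) follows. If a canonical M satisfying φ had a measurable cardinal, N would satisfy φ too.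
Transitive class models satisfy the formula `TM` (`realize_TM`), and the uniqueness sentence of φ
holds in V, so N = M, a contradiction.

The universe is an arbitrary first-order structure, so separation, replacement, induction and
recursion are available only for definable classes. `Def` and `DefF` express definability
semantically; their closure instances leave most definability proofs to instance search. -/

namespace CanonicalTruth

/-! ### Semantics of the formulas -/

section Semantics

variable {V : Type*}

/-- The value of a variable under an assignment. -/
def val {α : Type} {n : ℕ} (v : α → V) (xs : Fin n → V) (x : Var α n) : V := Sum.elim v xs x

section

variable {α : Type} {n : ℕ} {v : α → V} {xs : Fin n → V}

@[simp] theorem val_fv (a : α) : val v xs (fv a) = v a := rfl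

@[simp] theorem val_inr (i : Fin n) : val v xs (Sum.inr i) = xs i := rfl

@[simp] theorem val_new (a : V) : val v (Fin.snoc xs a : Fin (n + 1) → V) new = a := by
  simp [val, new]

@[simp] theorem val_up (a : V) (x : Var α n) :
    val v (Fin.snoc xs a : Fin (n + 1) → V) (up x) = val v xs x := by
  cases x <;> simp [val, up]

end

variable [LSet.Structure V]

/-- The membership relation of a structure for the language of set theory. -/
def SMem (x y : V) : Prop := Structure.RelMap (L := LSet) SetRel.mem ![x, y]

infix:50 " ε " => SMem

section

variable {α β : Type} {n : ℕ} {v : α → V} {xs : Fin n → V}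

@[simp] theorem realize_memF (x y : Var α n) :
    (memF x y).Realize v xs ↔ val v xs x ε val v xs y :=
  BoundedFormula.realize_rel₂

@[simp] theorem realize_eqF (x y : Var α n) :
    (eqF x y).Realize v xs ↔ val v xs x = val v xs y := by
  simp [eqF, val]

@[simp] theorem realize_allF (f : Var α (n + 1) → Fm α (n + 1)) :
    (allF f).Realize v xs ↔ ∀ a, (f new).Realize v (Fin.snoc xs a) := by
  simp [allF]

@[simp] theorem realize_exF (f : Var α (n + 1) → Fm α (n + 1)) :
    (exF f).Realize v xs ↔ ∃ a, (f new).Realize v (Fin.snoc xs a) := by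
  simp [exF]

@[simp] theorem realize_allIn (x : Var α n) (f : Var α (n + 1) → Fm α (n + 1)) :
    (allIn x f).Realize v xs ↔ ∀ a, a ε val v xs x → (f new).Realize v (Fin.snoc xs a) := by
  simp [allIn]

@[simp] theorem realize_exIn (x : Var α n) (f : Var α (n + 1) → Fm α (n + 1)) :
    (exIn x f).Realize v xs ↔ ∃ a, a ε val v xs x ∧ (f new).Realize v (Fin.snoc xs a) := by
  simp [exIn]

theorem realize_relabel_formula {α β : Type*} (ψ : LSet.Formula β) (σ : β → α ⊕ Fin n) {v : α → V} :
    (BoundedFormula.relabel (k := 0) σ ψ).Realize v xs ↔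
      ψ.Realize (fun b => Sum.elim v xs (σ b)) := by
  refine (BoundedFormula.realize_relabel (m := n) (φ := ψ)).trans ?_
  rw [Formula.Realize]
  exact iff_of_eq (congrArg₂ _ rfl (Subsingleton.elim _ _))

@[simp] theorem realize_inst (ψ : LSet.Formula β) (σ : β → Var α n) :
    (inst ψ σ).Realize v xs ↔ ψ.Realize (fun b => val v xs (σ b)) :=
  realize_relabel_formula ψ σ

theorem realize_univClosure {k : ℕ} (ψ : LSet.Formula (Fin k)) :
    V ⊨ univClosure ψ ↔ ∀ p : Fin k → V, ψ.Realize p := by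
  refine BoundedFormula.realize_alls.trans (forall_congr' fun p => ?_)
  exact realize_inst ψ Sum.inr

/-- `x ⊆ y` -/
def Sub (x y : V) : Prop := ∀ z, z ε x → z ε y

/-- `z = {x, y}` -/
def IsPair (z x y : V) : Prop := ∀ w, w ε z ↔ (w = x ∨ w = y)

/-- `z = (x, y)` -/
def IsOPair (z x y : V) : Prop := ∃ a b, IsPair a x x ∧ IsPair b x y ∧ IsPair z a b

/-- `(x, y) ∈ f` -/
def IsApp (f x y : V) : Prop := ∃ p, p ε f ∧ IsOPair p x y

/-- `f` is a function with domain `d`. -/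
def IsFun (f d : V) : Prop :=
  (∀ p, p ε f → ∃ x, x ε d ∧ ∃ y, IsOPair p x y) ∧
  (∀ x, x ε d → ∃ y, IsApp f x y ∧ ∀ y', IsApp f x y' → y' = y)

/-- `x` is an ordinal. -/
def Ord (x : V) : Prop := (∀ y, y ε x → Sub y x) ∧ ∀ y, y ε x → ∀ z, z ε y → Sub z y

/-- `w` is a nonzero limit ordinal. -/
def IsLim (w : V) : Prop := (Ord w ∧ ∃ x, x ε w) ∧ ∀ x, x ε w → ∃ y, y ε w ∧ x ε y

@[simp] theorem realize_subF (x y : Var α n) :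
    (subF x y).Realize v xs ↔ Sub (val v xs x) (val v xs y) := by simp [subF, Sub]

@[simp] theorem realize_emptyF (x : Var α n) :
    (emptyF x).Realize v xs ↔ ∀ z, ¬ z ε val v xs x := by simp [emptyF]

@[simp] theorem realize_pairF (z x y : Var α n) :
    (pairF z x y).Realize v xs ↔ IsPair (val v xs z) (val v xs x) (val v xs y) := by
  simp [pairF, IsPair]

@[simp] theorem realize_opairF (z x y : Var α n) :
    (opairF z x y).Realize v xs ↔ IsOPair (val v xs z) (val v xs x) (val v xs y) := by
  simp [opairF, IsOPair, and_assoc]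

@[simp] theorem realize_tripleF (z x y w : Var α n) :
    (tripleF z x y w).Realize v xs ↔ ∃ p, IsOPair p (val v xs x) (val v xs y) ∧
      IsOPair (val v xs z) p (val v xs w) := by
  simp [tripleF]

@[simp] theorem realize_appF (z x y : Var α n) :
    (appF z x y).Realize v xs ↔ IsApp (val v xs z) (val v xs x) (val v xs y) := by
  simp [appF, IsApp]

@[simp] theorem realize_funF (f d : Var α n) :
    (funF f d).Realize v xs ↔ IsFun (val v xs f) (val v xs d) := by
  simp [funF, IsFun]

@[simp] theorem realize_ordF (x : Var α n) :
    (ordF x).Realize v xs ↔ Ord (val v xs x) := by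
  simp [ordF, Ord]

@[simp] theorem realize_limF (x : Var α n) :
    (limF x).Realize v xs ↔ IsLim (val v xs x) := by
  simp [limF, IsLim]

end

end Semantics

/-! ### Definability with parameters -/

section Definability

variable {V : Type u} [LSet.Structure V] {A : Set V} {n m : ℕ}

/-- The predicate `P` is definable by a formula with parameters from `A`. -/
class Def (A : Set V) {n : ℕ} (P : (Fin n → V) → Prop) : Prop where
  out : ∃ φ : LSet.BoundedFormula A n, ∀ v, φ.Realize Subtype.val v ↔ P v

/-- The graph of the function `F` is definable by a formula with parameters from `A`. -/
class DefF (A : Set V) {n : ℕ} (F : (Fin n → V) → V) : Prop where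
  out : Def A (fun w : Fin (n + 1) → V => w (Fin.last n) = F (fun i => w i.castSucc))

theorem Def.congr {P Q : (Fin n → V) → Prop} (hP : Def A P) (h : ∀ v, P v ↔ Q v) : Def A Q := by
  rwa [show Q = P from funext fun v => propext (h v).symm]

theorem Def.of_formula {β : Type*} (ψ : LSet.Formula β) (σ : β → A ⊕ Fin n) :
    Def A (fun v : Fin n → V => ψ.Realize (fun b => Sum.elim Subtype.val v (σ b))) :=
  ⟨BoundedFormula.relabel (k := 0) σ ψ, fun _ => realize_relabel_formula ψ σ⟩

instance Def.const (p : Prop) : Def A (fun _ : Fin n → V => p) := by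
  by_cases h : p
  · exact ⟨⊤, by simp [h]⟩
  · exact ⟨⊥, by simp [h]⟩

instance Def.and {P Q : (Fin n → V) → Prop} [hP : Def A P] [hQ : Def A Q] :
    Def A (fun v => P v ∧ Q v) :=
  let ⟨φ, hφ⟩ := hP; let ⟨ψ, hψ⟩ := hQ; ⟨φ ⊓ ψ, by simp [hφ, hψ]⟩

instance Def.or {P Q : (Fin n → V) → Prop} [hP : Def A P] [hQ : Def A Q] :
    Def A (fun v => P v ∨ Q v) :=
  let ⟨φ, hφ⟩ := hP; let ⟨ψ, hψ⟩ := hQ; ⟨φ ⊔ ψ, by simp [hφ, hψ]⟩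

instance Def.imp {P Q : (Fin n → V) → Prop} [hP : Def A P] [hQ : Def A Q] :
    Def A (fun v => P v → Q v) :=
  let ⟨φ, hφ⟩ := hP; let ⟨ψ, hψ⟩ := hQ; ⟨φ.imp ψ, by simp [hφ, hψ]⟩

instance Def.iff {P Q : (Fin n → V) → Prop} [hP : Def A P] [hQ : Def A Q] :
    Def A (fun v => P v ↔ Q v) :=
  let ⟨φ, hφ⟩ := hP; let ⟨ψ, hψ⟩ := hQ; ⟨φ.iff ψ, by simp [hφ, hψ]⟩

instance Def.not {P : (Fin n → V) → Prop} [hP : Def A P] : Def A (fun v => ¬ P v) :=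
  let ⟨φ, hφ⟩ := hP; ⟨∼φ, by simp [hφ]⟩

/-- The bound variable is the last of `n + 1` coordinates, which is how quantifiers of
`BoundedFormula` bind. The other rules about bound variables use the same shape. -/
instance Def.all {P : (Fin n → V) → V → Prop}
    [hP : Def A (fun w : Fin (n + 1) → V => P (fun i => w i.castSucc) (w (Fin.last n)))] :
    Def A (fun v => ∀ x, P v x) :=
  let ⟨φ, hφ⟩ := hP; ⟨φ.all, by simp [hφ]⟩

instance Def.ex {P : (Fin n → V) → V → Prop}
    [hP : Def A (fun w : Fin (n + 1) → V => P (fun i => w i.castSucc) (w (Fin.last n)))] :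
    Def A (fun v => ∃ x, P v x) :=
  let ⟨φ, hφ⟩ := hP; ⟨φ.ex, by simp [hφ]⟩

theorem Def.eq_var (i j : Fin n) : Def A (fun v => v i = v j) :=
  ⟨Term.bdEqual (Term.var (Sum.inr i)) (Term.var (Sum.inr j)), by simp⟩

theorem Def.mem_var (i j : Fin n) : Def A (fun v => v i ε v j) :=
  ⟨Relations.boundedFormula₂ (L := LSet) SetRel.mem (Term.var (Sum.inr i)) (Term.var (Sum.inr j)),
    fun _ => BoundedFormula.realize_rel₂⟩

theorem Def.formula (ψ : LSet.Formula (Fin n)) : Def A (fun v : Fin n → V => ψ.Realize v) :=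
  Def.of_formula ψ Sum.inr

/-- Renaming of variables. -/
theorem Def.rename {P : (Fin n → V) → Prop} (hP : Def A P) (σ : Fin n → Fin m) :
    Def A (fun v : Fin m → V => P (fun i => v (σ i))) := by
  obtain ⟨φ, hφ⟩ := hP
  refine (Def.of_formula (A := A) φ.toFormula (Sum.map id σ)).congr fun v => ?_
  rw [BoundedFormula.realize_toFormula, ← hφ]
  rfl

instance DefF.var (i : Fin n) : DefF A (fun v => v i) := ⟨Def.eq_var _ _⟩

theorem DefF.graph {F : (Fin n → V) → V} (hF : DefF A F) (σ : Fin n → Fin m) (j : Fin m) :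
    Def A (fun v : Fin m → V => v j = F (fun i => v (σ i))) :=
  (hF.out.rename (Fin.snoc σ j : Fin (n + 1) → Fin m)).congr fun v => by simp

theorem DefF.of_graph {F : (Fin n → V) → V} {R : (Fin n → V) → V → Prop}
    (h : ∀ v y, y = F v ↔ R v y)
    [hR : Def A (fun w : Fin (n + 1) → V => R (fun i => w i.castSucc) (w (Fin.last n)))] :
    DefF A F :=
  ⟨hR.congr fun _ => (h _ _).symm⟩

/-- The language has no function symbols, so a definable function is substituted through its graph:
`P (F v)` becomes `∃ y, y = F v ∧ P y`. -/
theorem Def.comp {P : (Fin m → V) → Prop} [hP : Def A P] {F : Fin m → (Fin n → V) → V}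
    (hF : ∀ i, DefF A (F i)) : Def A (fun v => P (fun i => F i v)) := by
  -- The `n` original variables stay as a prefix on which every term depends; the `k` substituted
  -- coordinates are removed one at a time from the end.
  have key : ∀ (k : ℕ) (P : (Fin (n + k) → V) → Prop) (F : Fin k → (Fin n → V) → V), Def A P →
      (∀ i, DefF A (F i)) →  Def A (fun v => P (Fin.append v (fun i => F i v))) := by
    intro k
    induction k with
    | zero =>
      intro P F hP _
      refine (hP.rename (m := n) (fun i => i)).congr fun v => iff_of_eq (congrArg P ?_)
      funext i
      exact (Fin.append_left v (fun i => F i v) i).symm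
    | succ k ih =>
      intro P F hP hF
      have h1 : Def A (fun w : Fin (n + k) → V =>
          ∃ y, y = F (Fin.last k) (fun i => w (Fin.castAdd k i)) ∧ P (Fin.snoc w y)) := by
        have h2 := (hF (Fin.last k)).graph (m := n + k + 1) (fun i => (Fin.castAdd k i).castSucc)
          (Fin.last _)
        have h3 : Def A (fun w : Fin (n + k + 1) → V =>
          P (Fin.snoc (fun i => w i.castSucc) (w (Fin.last _)))) := hP.congr fun v =>
            iff_of_eq (congrArg P (Fin.snoc_init_self v).symm)
        exact Def.ex
      refine (ih _ (fun i => F i.castSucc) h1 fun i => hF _).congr fun v => ?_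
      simp only [exists_eq_left, Fin.append_left]
      refine iff_of_eq (congrArg P ?_)
      funext i
      refine Fin.lastCases ?_ (fun j => Fin.addCases (fun j => ?_) (fun j => ?_) j) i
      · rw [Fin.snoc_last]
        exact (Fin.append_right v (fun i => F i v) (Fin.last k)).symm
      · rw [Fin.snoc_castSucc, Fin.append_left]
        exact (Fin.append_left v (fun i => F i v) j).symm
      · rw [Fin.snoc_castSucc, Fin.append_right]
        exact (Fin.append_right v (fun i => F i v) j.castSucc).symm
  refine (key m (fun w => P fun i => w (Fin.natAdd n i)) F (hP.rename _) hF).congr fun v => ?_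
  simp

theorem Def.comp₁ (R : V → Prop) [hR : Def A (fun v : Fin 1 → V => R (v 0))]
    {F : (Fin n → V) → V} [hF : DefF A F] : Def A (fun v => R (F v)) :=
  Def.comp (P := fun v : Fin 1 → V => R (v 0)) (F := ![F]) (by simpa [Fin.forall_fin_succ])

theorem Def.comp₂ (R : V → V → Prop) [hR : Def A (fun v : Fin 2 → V => R (v 0) (v 1))]
    {F G : (Fin n → V) → V} [hF : DefF A F] [hG : DefF A G] : Def A (fun v => R (F v) (G v)) :=
  Def.comp (P := fun v : Fin 2 → V => R (v 0) (v 1)) (F := ![F, G])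
    (by simp [Fin.forall_fin_succ, hF, hG])

theorem Def.comp₄ (R : V → V → V → V → Prop)
    [hR : Def A (fun v : Fin 4 → V => R (v 0) (v 1) (v 2) (v 3))]
    {F G H K : (Fin n → V) → V} [hF : DefF A F] [hG : DefF A G] [hH : DefF A H] [hK : DefF A K] :
    Def A (fun v => R (F v) (G v) (H v) (K v)) :=
  Def.comp (P := fun v : Fin 4 → V => R (v 0) (v 1) (v 2) (v 3)) (F := ![F, G, H, K])
    (by simp [Fin.forall_fin_succ, hF, hG, hH, hK])

instance Def.mem {F G : (Fin n → V) → V} [DefF A F] [DefF A G] : Def A (fun v => F v ε G v) :=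
  have : Def A (fun v : Fin 2 → V => v 0 ε v 1) := Def.mem_var 0 1
  Def.comp₂ SMem

instance Def.eq {F G : (Fin n → V) → V} [DefF A F] [DefF A G] : Def A (fun v => F v = G v) :=
  have : Def A (fun v : Fin 2 → V => v 0 = v 1) := Def.eq_var 0 1
  Def.comp₂ Eq

theorem DefF.comp {G : (Fin m → V) → V} [hG : DefF A G] {F : Fin m → (Fin n → V) → V}
    (hF : ∀ i, DefF A (F i)) : DefF A (fun v => G (fun i => F i v)) := by
  constructor
  have h (i : Fin m) : DefF A (fun w : Fin (n + 1) → V => F i fun i => w i.castSucc) :=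
    ⟨(hF i).graph _ _⟩
  have := Def.comp (A := A) (n := n + 1) (hP := hG.out)
    (F := Fin.snoc (fun i w => F i (fun i => w i.castSucc)) fun w => w (Fin.last n)) (fun i => by
      refine Fin.lastCases ?_ (fun i => ?_) i
      · simp only [Fin.snoc_last]; infer_instance
      · simp only [Fin.snoc_castSucc]; infer_instance)
  simpa using this

theorem DefF.comp₁ (H : V → V) [hH : DefF A (fun v : Fin 1 → V => H (v 0))]
    {F : (Fin n → V) → V} [hF : DefF A F] : DefF A (fun v => H (F v)) :=
  DefF.comp (G := fun v : Fin 1 → V => H (v 0)) (F := ![F]) (by simpa [Fin.forall_fin_succ])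

theorem DefF.comp₂ (H : V → V → V) [hH : DefF A (fun v : Fin 2 → V => H (v 0) (v 1))]
    {F G : (Fin n → V) → V} [hF : DefF A F] [hG : DefF A G] : DefF A (fun v => H (F v) (G v)) :=
  DefF.comp (G := fun v : Fin 2 → V => H (v 0) (v 1)) (F := ![F, G])
    (by simp [Fin.forall_fin_succ, hF, hG])

theorem DefF.comp₃ (H : V → V → V → V) [hH : DefF A (fun v : Fin 3 → V => H (v 0) (v 1) (v 2))]
    {F G K : (Fin n → V) → V} [hF : DefF A F] [hG : DefF A G] [hK : DefF A K] :
    DefF A (fun v => H (F v) (G v) (K v)) :=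
  DefF.comp (G := fun v : Fin 3 → V => H (v 0) (v 1) (v 2)) (F := ![F, G, K])
    (by simp [Fin.forall_fin_succ, hF, hG, hK])

theorem DefF.const_of_mem {c : V} (hc : c ∈ A) : DefF A (fun _ : Fin n → V => c) :=
  ⟨⟨Term.bdEqual (Term.var (Sum.inr (Fin.last n))) (Term.var (Sum.inl ⟨c, hc⟩)), by simp⟩⟩

instance DefF.const (c : V) : DefF Set.univ (fun _ : Fin n → V => c) := DefF.const_of_mem trivial

/-- Definability is transitive in the parameters. -/
theorem Def.trans {B : Set V} {P : (Fin n → V) → Prop} (hP : Def A P)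
    (hA : ∀ a ∈ A, ∀ m, DefF B (fun _ : Fin m → V => a)) : Def B P := by
  obtain ⟨φ, hφ⟩ := hP
  refine Def.congr ?_ hφ
  have ht (k : ℕ) (t : LSet.Term (A ⊕ Fin k)) :
      DefF B (fun v : Fin k → V => t.realize (Sum.elim Subtype.val v)) := by
    rcases t with (a | i) | f
    · exact hA _ a.2 k
    · exact DefF.var i
    · cases f
  clear hφ P
  induction φ with
  | falsum => exact Def.const False
  | equal s t => exact Def.eq (F := fun v => s.realize _) (G := fun v => t.realize _)
  | rel R ts =>
    cases R
    refine (Def.mem (A := B) (F := fun v => (ts 0).realize (Sum.elim Subtype.val v))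
      (G := fun v => (ts 1).realize (Sum.elim Subtype.val v))).congr fun v => ?_
    refine Iff.trans (iff_of_eq (congrArg (Structure.RelMap (L := LSet) SetRel.mem) ?_))
      BoundedFormula.realize_rel.symm
    funext i; fin_cases i <;> rfl
  | imp φ ψ h1 h2 => exact Def.imp (hP := h1) (hQ := h2)
  | @all k φ h =>
    refine Def.all (P := fun v x => φ.Realize _ (Fin.snoc v x)) (hP := h.congr fun v => ?_)
    rw [show (Fin.snoc (fun i => v i.castSucc) (v (Fin.last _)) : Fin (k + 1) → V) = v from
      Fin.snoc_init_self v]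

/-- A definable class can be defined by a parameter-free formula with parameters as arguments. -/
theorem Def.exists_formula {P : (Fin n → V) → Prop} (hP : Def A P) :
    ∃ (k : ℕ) (ψ : LSet.Formula (Fin k ⊕ Fin n)) (p : Fin k → V),
      ∀ v, ψ.Realize (Sum.elim p v) ↔ P v := by
  classical
  obtain ⟨φ, hφ⟩ := hP
  let e := Fintype.equivFin φ.freeVarFinset
  refine ⟨_, (φ.restrictFreeVar e).toFormula, fun i => (e.symm i).1.1, fun v => ?_⟩
  rw [BoundedFormula.realize_toFormula, ← hφ,
    BoundedFormula.realize_restrictFreeVar (Subtype.val : A → V)]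
  · rfl
  · intro a; simp

/-- The shape demanded of a class model: a formula in two variables, the element being variable 0
and the single parameter variable 1. -/
theorem Def.exists_formula_singleton {t : V} {P : (Fin 1 → V) → Prop} (hP : Def {t} P) :
    ∃ ψ : LSet.Formula (Fin 2), ∀ x, ψ.Realize ![x, t] ↔ P ![x] := by
  obtain ⟨φ, hφ⟩ := hP
  refine ⟨φ.toFormula.relabel (Sum.elim (fun _ => 1) (fun _ => 0)), fun x => ?_⟩
  rw [Formula.realize_relabel, BoundedFormula.realize_toFormula, ← hφ]
  refine iff_of_eq (congrArg₂ _ ?_ ?_)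
  · funext a; exact a.2.symm
  · funext i; fin_cases i; rfl

/-- Łoś's theorem is stated for formulas without parameters; this lets it be applied to a predicate
shown definable by instance search. -/
theorem Def.exists_formula_empty {P : (Fin n → V) → Prop} (hP : Def (∅ : Set V) P) :
    ∃ ψ : LSet.BoundedFormula Empty n, ∀ v, ψ.Realize default v ↔ P v := by
  obtain ⟨φ, hφ⟩ := hP
  refine ⟨inst (α := Empty) (φ.toFormula.relabel (Sum.elim (fun a => a.2.elim) id)) Sum.inr,
    fun v => ?_⟩
  rw [realize_inst, Formula.realize_relabel, BoundedFormula.realize_toFormula, ← hφ]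
  refine iff_of_eq (congrArg₂ _ ?_ rfl)
  funext a; exact a.2.elim

instance Def.sub {F G : (Fin n → V) → V} [DefF A F] [DefF A G] : Def A (fun v => Sub (F v) (G v)) :=
  have : Def A (fun v : Fin 2 → V => Sub (v 0) (v 1)) := by unfold Sub; infer_instance
  Def.comp₂ Sub

instance Def.ord {F : (Fin n → V) → V} [DefF A F] : Def A (fun v => Ord (F v)) :=
  have : Def A (fun v : Fin 1 → V => Ord (v 0)) := by unfold Ord; infer_instance
  Def.comp₁ Ord

theorem DefF.rename {F : (Fin n → V) → V} (hF : DefF A F) (σ : Fin n → Fin m) :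
    DefF A (fun v : Fin m → V => F (fun i => v (σ i))) := ⟨hF.graph _ _⟩

/-- Serves to restate a definability hypothesis for all longer contexts at once, so that instance
search can use it under additional quantifiers. -/
theorem Def.rename_snoc {P : (Fin n → V) → V → Prop}
    (hP : Def A (fun w : Fin (n + 1) → V => P (fun i => w i.castSucc) (w (Fin.last n))))
    (σ : Fin n → Fin m) (j : Fin m) : Def A (fun v : Fin m → V => P (fun i => v (σ i)) (v j)) :=
  (hP.rename (Fin.snoc σ j : Fin (n + 1) → Fin m)).congr fun v => by simp

theorem DefF.rename_snoc {F : (Fin n → V) → V → V}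
    (hF : DefF A (fun w : Fin (n + 1) → V => F (fun i => w i.castSucc) (w (Fin.last n))))
    (σ : Fin n → Fin m) (j : Fin m) : DefF A (fun v : Fin m → V => F (fun i => v (σ i)) (v j)) := by
  simpa using hF.rename (Fin.snoc σ j : Fin (n + 1) → Fin m)

end Definability

/-! ### Set theory inside a model of ZFC -/

/-- The structure `V` is a model of ZFC. -/
class ZFCModel (V : Type u) [LSet.Structure V] : Prop where
  models : V ⊨ ZFC

section Axioms

variable {V : Type u} [LSet.Structure V] [ZFCModel V]

theorem realize_of_mem_ZFC {σ : LSet.Sentence} (h : σ ∈ ZFC) : V ⊨ σ :=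
  ZFCModel.models.realize_of_mem σ h

theorem set_ext {x y : V} (h : ∀ z, z ε x ↔ z ε y) : x = y := by
  have := realize_of_mem_ZFC (V := V) (σ := extensionality) (by simp [ZFC])
  simp [extensionality, Sentence.Realize, Formula.Realize] at this
  exact this x y h

theorem exists_min_of_mem {x y : V} (h : y ε x) : ∃ y, y ε x ∧ ∀ z, z ε x → ¬ z ε y := by
  have := realize_of_mem_ZFC (V := V) (σ := foundation) (by simp [ZFC])
  simp [foundation, Sentence.Realize, Formula.Realize] at this
  exact this x y h

theorem exists_upair (x y : V) : ∃ z, ∀ w, w ε z ↔ w = x ∨ w = y := by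
  have := realize_of_mem_ZFC (V := V) (σ := pairing) (by simp [ZFC])
  simp [pairing, Sentence.Realize, Formula.Realize] at this
  exact this x y

theorem exists_sUnion (x : V) : ∃ y, ∀ z, z ε y ↔ ∃ t, t ε x ∧ z ε t := by
  have := realize_of_mem_ZFC (V := V) (σ := unionAx) (by simp [ZFC])
  simp [unionAx, Sentence.Realize, Formula.Realize] at this
  exact this x

theorem exists_powset (x : V) : ∃ y, ∀ z, z ε y ↔ Sub z x := by
  have := realize_of_mem_ZFC (V := V) (σ := powerset) (by simp [ZFC])
  simp [powerset, Sentence.Realize, Formula.Realize] at this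
  exact this x

theorem exists_transversal (x : V) (h : ∀ y, y ε x → ∃ z, z ε y)
    (h' : ∀ y, y ε x → ∀ y', y' ε x → ∀ z, z ε y → z ε y' → y = y') :
    ∃ c, ∀ y, y ε x → ∃ z, ∀ t, (t ε y ∧ t ε c) ↔ t = z := by
  have := realize_of_mem_ZFC (V := V) (σ := choice) (by simp [ZFC])
  simp [choice, Sentence.Realize, Formula.Realize] at this
  exact this x h h'

theorem exists_sep (a : V) (P : V → Prop) [hP : Def Set.univ (fun v : Fin 1 → V => P (v 0))] :
    ∃ b, ∀ z, z ε b ↔ z ε a ∧ P z := by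
  obtain ⟨k, ψ, p, hψ⟩ := hP.exists_formula
  have := realize_of_mem_ZFC (V := V) (σ := separation k ψ) (Or.inl (Or.inr ⟨k, ψ, rfl⟩))
  obtain ⟨b, hb⟩ := (realize_exF _).1 ((realize_allF _).1 ((realize_univClosure _).1 this p) a)
  simp only [realize_allF, BoundedFormula.realize_iff, BoundedFormula.realize_inf, realize_memF,
    realize_inst, val_new, val_up] at hb
  refine ⟨b, fun z => (hb z).trans (and_congr_right fun _ => ?_)⟩
  refine Iff.trans (iff_of_eq (congrArg _ ?_)) (hψ ![z])
  funext i
  rcases i with i | i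
  · simp
  · fin_cases i; simp

theorem exists_repl (a : V) (R : V → V → Prop)
    [hR : Def Set.univ (fun v : Fin 2 → V => R (v 0) (v 1))]
    (h : ∀ x, x ε a → ∀ y y', R x y → R x y' → y = y') :
    ∃ b, ∀ y, y ε b ↔ ∃ x, x ε a ∧ R x y := by
  obtain ⟨k, ψ, p, hψ⟩ := hR.exists_formula
  have := realize_of_mem_ZFC (V := V) (σ := replacement k ψ) (Or.inr ⟨k, ψ, rfl⟩)
  -- The axiom contains `ψ` under contexts of different lengths; this equivalence depends only on
  -- the values of the variables and covers them all.
  have key : ∀ x y {n : ℕ} (xs : Fin n → V) (i j : Var (Fin k) n), val p xs i = x → val p xs j = y →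
      (ψ.Realize (fun b => val p xs (Sum.elim fv ![i, j] b)) ↔ R x y) := by
    intro x y n xs i j hi hj
    refine Iff.trans (iff_of_eq (congrArg _ ?_)) (hψ ![x, y])
    funext i
    rcases i with i | i
    · simp
    · fin_cases i <;> simp [hi, hj]
  have h1 := (realize_allF _).1 ((realize_univClosure _).1 this p) a
  simp only [realize_allF, BoundedFormula.realize_imp, BoundedFormula.realize_inf, realize_allIn,
    realize_inst, val_new, realize_exF, BoundedFormula.realize_iff, realize_memF, realize_exIn,
    realize_eqF, val_up] at h1
  obtain ⟨b, hb⟩ := h1 fun x hx y y' hyy => h x hx y y'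
    ((key x y _ _ _ (by simp) (by simp)).1 hyy.1) ((key x y' _ _ _ (by simp) (by simp)).1 hyy.2)
  exact ⟨b, fun y => (hb y).trans (exists_congr fun x => and_congr_right fun _ =>
    key x y _ _ _ (by simp) (by simp))⟩

/-- Infinity yields only an element here. The limit ordinals needed later come from below the
measurable cardinal. -/
instance (priority := low) ZFCModel.nonempty : Nonempty V := by
  have := realize_of_mem_ZFC (V := V) (σ := infinity) (by simp [ZFC])
  obtain ⟨w, -⟩ := (realize_exF _).1 this
  exact ⟨w⟩

end Axioms

/-! ### Set-theoretic operations as definable terms -/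

section Terms

variable {V : Type u} [LSet.Structure V] [ZFCModel V] {A : Set V} {n m : ℕ}

theorem exists_empty : ∃ e : V, ∀ z, ¬ z ε e := by
  obtain ⟨a⟩ := (inferInstance : Nonempty V)
  obtain ⟨b, hb⟩ := exists_sep a (fun _ => False)
  exact ⟨b, fun z hz => ((hb z).1 hz).2⟩

/-- The empty set. -/
noncomputable def emp : V := (exists_empty (V := V)).choose

@[simp] theorem not_mem_emp (z : V) : ¬ z ε emp := exists_empty.choose_spec z

theorem eq_emp_iff (x : V) : x = emp ↔ ∀ z, ¬ z ε x :=
  ⟨fun h => h ▸ not_mem_emp, fun h => set_ext fun z => iff_of_false (h z) (not_mem_emp z)⟩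

open Classical in
/-- The unique `y` with `P y`, or the empty set if there is none. -/
noncomputable def the (P : V → Prop) : V := if h : ∃! y, P y then h.choose else emp

theorem the_eq {P : V → Prop} {y : V} (h : P y) (h' : ∀ z, P z → z = y) : the P = y := by
  have h1 : ∃! y, P y := ⟨y, h, h'⟩
  rw [the, dif_pos h1]
  exact h' _ h1.choose_spec.1

theorem the_spec {P : V → Prop} (h : ∃ y, P y) (h' : ∀ y z, P y → P z → y = z) : P (the P) := by
  obtain ⟨y, hy⟩ := h
  rwa [the_eq hy fun z hz => h' _ _ hz hy]

/-- The default value ∅ is part of the graph, so `the` is definable whether or not the description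
is proper. -/
theorem eq_the_iff (P : V → Prop) (y : V) :
    y = the P ↔ (P y ∧ ∀ z, P z → z = y) ∨ ((¬ ∃ y, P y ∧ ∀ z, P z → z = y) ∧ ∀ z, ¬ z ε y) := by
  by_cases h : ∃ y, P y ∧ ∀ z, P z → z = y
  · obtain ⟨x, hx, hx'⟩ := h
    rw [the_eq hx hx']
    constructor
    · rintro rfl; exact Or.inl ⟨hx, hx'⟩
    · rintro (⟨h1, -⟩ | ⟨h1, -⟩)
      · exact hx' _ h1
      · exact (h1 ⟨x, hx, hx'⟩).elim
  · rw [the, dif_neg (by simpa [ExistsUnique] using h), eq_emp_iff]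
    constructor
    · exact fun h1 => Or.inr ⟨h, h1⟩
    · rintro (h1 | ⟨-, h1⟩)
      · exact (h ⟨y, h1⟩).elim
      · exact h1

theorem the_set_spec {P : V → Prop} (h : ∃ b, ∀ z, z ε b ↔ P z) (z : V) :
    z ε the (fun b => ∀ z, z ε b ↔ P z) ↔ P z :=
  the_spec h (fun _ _ h1 h2 => set_ext fun z => (h1 z).trans (h2 z).symm) z

instance DefF.the {P : (Fin n → V) → V → Prop}
    [hP : Def A (fun w : Fin (n + 1) → V => P (fun i => w i.castSucc) (w (Fin.last n)))] :
    DefF A (fun v => the (P v)) := by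
  have h1 (m : ℕ) (σ : Fin n → Fin m) (j : Fin m) := hP.rename_snoc σ j
  exact DefF.of_graph fun v y => eq_the_iff _ _

instance DefF.emp : DefF A (fun _ : Fin n → V => emp) := DefF.of_graph fun _ y => eq_emp_iff y

/-- The set of all `z ∈ a` with `P z`. -/
noncomputable def sep (a : V) (P : V → Prop) : V := the fun b => ∀ z, z ε b ↔ z ε a ∧ P z

theorem mem_sep {a : V} {P : V → Prop} [Def Set.univ (fun v : Fin 1 → V => P (v 0))] {z : V} :
    z ε sep a P ↔ z ε a ∧ P z := the_set_spec (exists_sep a P) z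

instance DefF.sep {F : (Fin n → V) → V} {P : (Fin n → V) → V → Prop} [hF : DefF A F]
    [hP : Def A (fun w : Fin (n + 1) → V => P (fun i => w i.castSucc) (w (Fin.last n)))] :
    DefF A (fun v => sep (F v) (P v)) := by
  have h1 (m : ℕ) (σ : Fin n → Fin m) (j : Fin m) := hP.rename_snoc σ j
  have h2 (m : ℕ) (σ : Fin n → Fin m) := hF.rename σ
  unfold CanonicalTruth.sep
  infer_instance

/-- The set of all `F x` for `x ∈ a`. -/
noncomputable def img (a : V) (F : V → V) : V := the fun b => ∀ y, y ε b ↔ ∃ x, x ε a ∧ y = F x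

theorem mem_img {a : V} {F : V → V} [hF : DefF Set.univ (fun v : Fin 1 → V => F (v 0))] {y : V} :
    y ε img a F ↔ ∃ x, x ε a ∧ y = F x :=
  have : Def Set.univ (fun v : Fin 2 → V => v 1 = F (v 0)) := hF.graph (fun _ => 0) 1
  the_set_spec (exists_repl a (fun x y => y = F x) fun _ _ _ _ h h' => h.trans h'.symm) y

instance DefF.img {F : (Fin n → V) → V} {G : (Fin n → V) → V → V} [hF : DefF A F]
    [hG : DefF A (fun w : Fin (n + 1) → V => G (fun i => w i.castSucc) (w (Fin.last n)))] :
    DefF A (fun v => img (F v) (G v)) := by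
  have h1 (m : ℕ) (σ : Fin n → Fin m) (j : Fin m) := hG.rename_snoc σ j
  have h2 (m : ℕ) (σ : Fin n → Fin m) := hF.rename σ
  unfold CanonicalTruth.img
  infer_instance

/-- The unordered pair. -/
noncomputable def upair (x y : V) : V := the fun z => ∀ w, w ε z ↔ w = x ∨ w = y

@[simp] theorem mem_upair {x y z : V} : z ε upair x y ↔ z = x ∨ z = y :=
  the_set_spec (exists_upair x y) z

instance DefF.upair {F G : (Fin n → V) → V} [DefF A F] [DefF A G] :
    DefF A (fun v => upair (F v) (G v)) :=
  have : DefF A (fun v : Fin 2 → V => CanonicalTruth.upair (v 0) (v 1)) := by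
    unfold CanonicalTruth.upair; infer_instance
  DefF.comp₂ CanonicalTruth.upair

/-- The union of the elements of a set. -/
noncomputable def sUnion (x : V) : V := the fun y => ∀ z, z ε y ↔ ∃ t, t ε x ∧ z ε t

@[simp] theorem mem_sUnion {x z : V} : z ε sUnion x ↔ ∃ t, t ε x ∧ z ε t :=
  the_set_spec (exists_sUnion x) z

instance DefF.sUnion {F : (Fin n → V) → V} [DefF A F] : DefF A (fun v => sUnion (F v)) :=
  have : DefF A (fun v : Fin 1 → V => CanonicalTruth.sUnion (v 0)) := by
    unfold CanonicalTruth.sUnion; infer_instance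
  DefF.comp₁ CanonicalTruth.sUnion

/-- The power set. -/
noncomputable def powset (x : V) : V := the fun y => ∀ z, z ε y ↔ Sub z x

@[simp] theorem mem_powset {x z : V} : z ε powset x ↔ Sub z x :=
  the_set_spec (exists_powset x) z

instance DefF.powset {F : (Fin n → V) → V} [DefF A F] : DefF A (fun v => powset (F v)) :=
  have : DefF A (fun v : Fin 1 → V => CanonicalTruth.powset (v 0)) := by
    unfold CanonicalTruth.powset; infer_instance
  DefF.comp₁ CanonicalTruth.powset

/-- The union of two sets. -/
noncomputable def union (x y : V) : V := sUnion (upair x y)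

@[simp] theorem mem_union {x y z : V} : z ε union x y ↔ z ε x ∨ z ε y := by simp [union]

instance DefF.union {F G : (Fin n → V) → V} [DefF A F] [DefF A G] :
    DefF A (fun v => union (F v) (G v)) := by unfold CanonicalTruth.union; infer_instance

/-- The singleton. -/
noncomputable def sing (x : V) : V := upair x x

@[simp] theorem mem_sing {x z : V} : z ε sing x ↔ z = x := by simp [sing]

instance DefF.sing {F : (Fin n → V) → V} [DefF A F] : DefF A (fun v => sing (F v)) := by
  unfold CanonicalTruth.sing; infer_instance

/-- The ordinal successor. -/
noncomputable def succ (x : V) : V := union x (sing x)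

@[simp] theorem mem_succ {x z : V} : z ε succ x ↔ z ε x ∨ z = x := by simp [succ]

instance DefF.succ {F : (Fin n → V) → V} [DefF A F] : DefF A (fun v => succ (F v)) := by
  unfold CanonicalTruth.succ; infer_instance

/-- The ordered pair. -/
noncomputable def opair (x y : V) : V := upair (sing x) (upair x y)

instance DefF.opair {F G : (Fin n → V) → V} [DefF A F] [DefF A G] :
    DefF A (fun v => opair (F v) (G v)) := by unfold CanonicalTruth.opair; infer_instance

theorem isPair_iff {z x y : V} : IsPair z x y ↔ z = upair x y :=
  ⟨fun h => set_ext fun w => (h w).trans mem_upair.symm, fun h => h ▸ fun _ => mem_upair⟩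

theorem isOPair_iff {z x y : V} : IsOPair z x y ↔ z = opair x y := by
  simp [IsOPair, isPair_iff, opair, sing]

theorem isApp_iff {f x y : V} : IsApp f x y ↔ opair x y ε f := by
  simp [IsApp, isOPair_iff]

theorem upair_inj_right {x y z : V} (h : upair x y = upair x z) : y = z := by
  have h1 : y ε upair x z := h ▸ mem_upair.2 (Or.inr rfl)
  have h2 : z ε upair x y := h ▸ mem_upair.2 (Or.inr rfl)
  rw [mem_upair] at h1 h2
  rcases h1 with rfl | h1
  · rcases h2 with h2 | h2 <;> exact h2.symm
  · exact h1

theorem opair_inj {x y x' y' : V} : opair x y = opair x' y' ↔ x = x' ∧ y = y' := by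
  constructor
  · intro h
    have hx : x = x' := by
      have h1 : sing x ε opair x' y' := h ▸ mem_upair.2 (Or.inl rfl)
      rcases mem_upair.1 h1 with h1 | h1
      · exact mem_sing.1 (h1 ▸ mem_sing.2 rfl)
      · exact (mem_sing.1 (h1 ▸ mem_upair.2 (Or.inl rfl) : x' ε sing x)).symm
    subst hx
    exact ⟨rfl, upair_inj_right (upair_inj_right h)⟩
  · rintro ⟨rfl, rfl⟩; rfl

/-- The cartesian product. -/
noncomputable def prod (a b : V) : V := sUnion (img a fun x => img b fun y => opair x y)

theorem mem_prod {a b z : V} : z ε prod a b ↔ ∃ x, x ε a ∧ ∃ y, y ε b ∧ z = opair x y := by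
  simp only [prod, mem_sUnion, mem_img]
  constructor
  · rintro ⟨t, ⟨x, hx, rfl⟩, h⟩
    exact ⟨x, hx, mem_img.1 h⟩
  · rintro ⟨x, hx, h⟩
    exact ⟨_, ⟨x, hx, rfl⟩, mem_img.2 h⟩

/-- The value of the function `f` at `x`. -/
noncomputable def app (f x : V) : V := the fun y => opair x y ε f

instance DefF.app {F G : (Fin n → V) → V} [DefF A F] [DefF A G] :
    DefF A (fun v => app (F v) (G v)) :=
  have : DefF A (fun v : Fin 2 → V => CanonicalTruth.app (v 0) (v 1)) := by
    unfold CanonicalTruth.app; infer_instance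
  DefF.comp₂ CanonicalTruth.app

theorem isFun_iff {f d : V} : IsFun f d ↔ (∀ p, p ε f → ∃ x, x ε d ∧ ∃ y, p = opair x y) ∧
    (∀ x, x ε d → ∃ y, opair x y ε f ∧ ∀ y', opair x y' ε f → y' = y) := by
  simp only [IsFun, isOPair_iff, isApp_iff]

instance Def.isFun {F G : (Fin n → V) → V} [DefF A F] [DefF A G] :
    Def A (fun v => IsFun (F v) (G v)) :=
  have : Def A (fun v : Fin 2 → V => IsFun (v 0) (v 1)) := by
    simp only [isFun_iff]; infer_instance
  Def.comp₂ IsFun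

theorem IsFun.app_mem {f d x : V} (h : IsFun f d) (hx : x ε d) : opair x (app f x) ε f := by
  obtain ⟨y, hy, hy'⟩ := (isFun_iff.1 h).2 x hx
  rwa [app, the_eq (P := fun y => opair x y ε f) hy hy']

theorem IsFun.mem_dom {f d x y : V} (h : IsFun f d) (hx : opair x y ε f) : x ε d := by
  obtain ⟨x', hx', y', h'⟩ := (isFun_iff.1 h).1 _ hx
  rwa [(opair_inj.1 h').1]

theorem IsFun.app_eq {f d x y : V} (h : IsFun f d) (hx : opair x y ε f) : app f x = y := by
  obtain ⟨y', hy, hy'⟩ := (isFun_iff.1 h).2 x (h.mem_dom hx)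
  rw [app, the_eq (P := fun y => opair x y ε f) hy hy', hy' _ hx]

/-- The function `x ↦ F x` on `a`. -/
noncomputable def lam (a : V) (F : V → V) : V := img a fun x => opair x (F x)

instance DefF.lam {F : (Fin n → V) → V} {G : (Fin n → V) → V → V} [hF : DefF A F]
    [hG : DefF A (fun w : Fin (n + 1) → V => G (fun i => w i.castSucc) (w (Fin.last n)))] :
    DefF A (fun v => lam (F v) (G v)) := by
  unfold CanonicalTruth.lam
  infer_instance

section lam

variable {a : V} {F : V → V} [hF : DefF Set.univ (fun v : Fin 1 → V => F (v 0))]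

theorem mem_lam {z : V} : z ε lam a F ↔ ∃ x, x ε a ∧ z = opair x (F x) := mem_img

theorem opair_mem_lam {x y : V} : opair x y ε lam a F ↔ x ε a ∧ y = F x := by
  rw [mem_lam]
  constructor
  · rintro ⟨x', hx, h⟩
    obtain ⟨rfl, rfl⟩ := opair_inj.1 h
    exact ⟨hx, rfl⟩
  · rintro ⟨hx, rfl⟩
    exact ⟨x, hx, rfl⟩

theorem isFun_lam : IsFun (lam a F) a := by
  refine isFun_iff.2 ⟨fun p hp => ?_, fun x hx => ⟨F x, opair_mem_lam.2 ⟨hx, rfl⟩, fun y' h =>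
    (opair_mem_lam.1 h).2⟩⟩
  obtain ⟨x, hx, h⟩ := mem_lam.1 hp
  exact ⟨x, hx, _, h⟩

theorem app_lam {x : V} (hx : x ε a) : app (lam a F) x = F x :=
  isFun_lam.app_eq (opair_mem_lam.2 ⟨hx, rfl⟩)

end lam

end Terms

/-! ### Ordinals -/

section Ordinals

variable {V : Type u} [LSet.Structure V]

theorem Ord.mem_trans {x y z : V} (hz : Ord z) (hx : x ε y) (hy : y ε z) : x ε z := hz.1 y hy x hx

theorem Ord.of_mem {x y : V} (hx : Ord x) (h : y ε x) : Ord y :=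
  ⟨hx.2 y h, fun z hz => hx.2 z (hx.mem_trans hz h)⟩

variable [ZFCModel V]

theorem not_mem_self (x : V) : ¬ x ε x := by
  intro h
  obtain ⟨y, hy, hy'⟩ := exists_min_of_mem (mem_sing.2 (rfl : x = x))
  rw [mem_sing] at hy
  subst hy
  exact hy' y (mem_sing.2 rfl) h

/-- Separation collects the counterexamples below `x` into a set, and foundation gives a minimal
one. -/
theorem Ord.induction {P : V → Prop} [hP : Def Set.univ (fun v : Fin 1 → V => P (v 0))]
    (h : ∀ x, Ord x → (∀ y, y ε x → P y) → P x) {x : V} (hx : Ord x) : P x := by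
  refine h x hx ?_
  by_contra! hc
  obtain ⟨y, hy, hy'⟩ := hc
  -- Restates `hP` for substituted terms, so that instance search handles formulas built from `P`.
  have hP' {n} {F : (Fin n → V) → V} [DefF Set.univ F] : Def Set.univ (fun v => P (F v)) :=
    Def.comp₁ P
  obtain ⟨m, hm, hm'⟩ := exists_min_of_mem
    (mem_sep.2 ⟨hy, hy'⟩ : y ε sep x fun y => ¬ P y)
  rw [mem_sep] at hm
  refine hm.2 (h m (hx.of_mem hm.1) fun z hz => ?_)
  by_contra hz'
  exact hm' z (mem_sep.2 ⟨hx.mem_trans hz hm.1, hz'⟩) hz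

theorem Ord.exists_least {P : V → Prop} [hP : Def Set.univ (fun v : Fin 1 → V => P (v 0))]
    {x : V} (hx : Ord x) (h : P x) : ∃ x, Ord x ∧ P x ∧ ∀ y, y ε x → ¬ P y := by
  by_contra! hc
  have hP' {n} {F : (Fin n → V) → V} [DefF Set.univ F] : Def Set.univ (fun v => P (F v)) :=
    Def.comp₁ P
  refine Ord.induction (P := fun x => ¬ P x) (fun x hx ih hx' => ?_) hx h
  obtain ⟨y, hy, hy'⟩ := hc x hx hx'
  exact ih y hy hy'

theorem Ord.trichotomy {a b : V} (ha : Ord a) (hb : Ord b) : a ε b ∨ a = b ∨ b ε a := by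
  revert b
  refine Ord.induction (P := fun a => ∀ {b}, Ord b → a ε b ∨ a = b ∨ b ε a) (fun a ha iha => ?_) ha
  intro b hb
  refine Ord.induction (P := fun b => a ε b ∨ a = b ∨ b ε a) (fun b hb ihb => ?_) hb
  by_contra! hc
  refine hc.2.1 (set_ext fun z => ⟨fun hz => ?_, fun hz => ?_⟩)
  · rcases iha z hz hb with h | rfl | h
    · exact h
    · exact (hc.2.2 hz).elim
    · exact (hc.2.2 (ha.mem_trans h hz)).elim
  · rcases ihb z hz with h | rfl | h
    · exact (hc.1 (hb.mem_trans h hz)).elim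
    · exact (hc.1 hz).elim
    · exact h

theorem Ord.mem_or_eq_of_sub {a b : V} (ha : Ord a) (hb : Ord b) (h : Sub a b) :
    a ε b ∨ a = b := by
  rcases ha.trichotomy hb with h' | h' | h'
  · exact Or.inl h'
  · exact Or.inr h'
  · exact (not_mem_self b (h b h')).elim

theorem Ord.sub_of_not_mem {a b : V} (ha : Ord a) (hb : Ord b) (h : ¬ b ε a) : Sub a b := by
  rcases ha.trichotomy hb with h' | rfl | h'
  · exact hb.1 a h'
  · exact fun _ => id
  · exact (h h').elim

theorem Ord.succ {a : V} (ha : Ord a) : Ord (succ a) := by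
  constructor
  · intro y hy z hz
    rcases mem_succ.1 hy with hy | rfl
    · exact mem_succ.2 (Or.inl (ha.mem_trans hz hy))
    · exact mem_succ.2 (Or.inl hz)
  · intro y hy
    rcases mem_succ.1 hy with hy | rfl
    · exact ha.2 y hy
    · exact ha.1

theorem Ord.sUnion {a : V} (h : ∀ x, x ε a → Ord x) : Ord (sUnion a) := by
  constructor
  · intro y hy z hz
    obtain ⟨t, ht, hy⟩ := mem_sUnion.1 hy
    exact mem_sUnion.2 ⟨t, ht, (h t ht).mem_trans hz hy⟩
  · intro y hy
    obtain ⟨t, ht, hy⟩ := mem_sUnion.1 hy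
    exact (h t ht).2 y hy

/-- Makes the union the predecessor function on successor ordinals; `iterate` recurses along it. -/
theorem sUnion_succ {a : V} (ha : Ord a) : CanonicalTruth.sUnion (CanonicalTruth.succ a) = a := by
  refine set_ext fun z => ?_
  rw [mem_sUnion]
  constructor
  · rintro ⟨t, ht, hz⟩
    rcases mem_succ.1 ht with ht | rfl
    · exact ha.mem_trans hz ht
    · exact hz
  · exact fun hz => ⟨a, mem_succ.2 (Or.inr rfl), hz⟩

theorem IsLim.succ_mem {w n : V} (hw : IsLim w) (hn : n ε w) : CanonicalTruth.succ n ε w := by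
  obtain ⟨y, hy, hny⟩ := hw.2 n hn
  have ho := hw.1.1
  have hs : Sub (CanonicalTruth.succ n) y := by
    intro z hz
    rcases mem_succ.1 hz with hz | rfl
    · exact (ho.of_mem hy).mem_trans hz hny
    · exact hny
  rcases (ho.of_mem hn).succ.mem_or_eq_of_sub (ho.of_mem hy) hs with h | h
  · exact ho.mem_trans h hy
  · rwa [h]

end Ordinals

/-! ### Recursion on set-like well-founded classes -/

section Recursion

variable {V : Type u} [LSet.Structure V] [ZFCModel V]

/-- The predecessors of every set under the class relation `E` form a set. -/
def SetLike (E : V → V → Prop) : Prop := ∀ x, ∃ s, ∀ y, y ε s ↔ E y x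

/-- Induction along `E` holds for definable classes. -/
def HasInduction (E : V → V → Prop) : Prop :=
  ∀ P : V → Prop, Def Set.univ (fun v : Fin 1 → V => P (v 0)) →
    (∀ x, (∀ y, E y x → P y) → P x) → ∀ x, P x

theorem HasInduction.irrefl {V : Type u} [LSet.Structure V] {E : V → V → Prop}
    [hdE : Def Set.univ (fun v : Fin 2 → V => E (v 0) (v 1))] (hwf : HasInduction E) (x : V) : ¬ E x x := by
  have hE' {n} {F F' : (Fin n → V) → V} [DefF Set.univ F] [DefF Set.univ F'] :
      Def Set.univ (fun v => E (F v) (F' v)) := Def.comp₂ E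
  exact hwf (fun x => ¬ E x x) inferInstance (fun x ih h => ih x h h) x

/-- The set of predecessors of `x`. -/
noncomputable def ext (E : V → V → Prop) (x : V) : V := the fun s => ∀ y, y ε s ↔ E y x

theorem SetLike.mem_ext {E : V → V → Prop} (hE : SetLike E) {x y : V} : y ε ext E x ↔ E y x :=
  the_set_spec (hE x) y

/-- The restriction of `h` to the predecessors of `x`. -/
noncomputable def res (E : V → V → Prop) (h x : V) : V :=
  sep h fun p => ∃ z, E z x ∧ ∃ w, p = opair z w

/-- `h` is a function on a class closed under `E`-predecessors that satisfies the recursion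
`h x = G x (h ↾ ext x)`. -/
def IsAttempt (E : V → V → Prop) (G : V → V → V) (h : V) : Prop :=
  ∀ x y, opair x y ε h → y = G x (res E h x) ∧ ∀ z, E z x → ∃ w, opair z w ε h

/-- The function defined by recursion on `E` from `G`. -/
noncomputable def recF (E : V → V → Prop) (G : V → V → V) (x : V) : V :=
  the fun y => ∃ h, IsAttempt E G h ∧ opair x y ε h

/-- The relation may depend on two further variables, so that `coll` is definable from `k`, `u` and
`f` without parameters. No well-foundedness is needed, since `recF` is given by an explicit
description. -/
theorem DefF.recF {A : Set V} (E : V → V → V → V → Prop) (G : V → V → V)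
    [hE : Def A (fun v : Fin 4 → V => E (v 0) (v 1) (v 2) (v 3))]
    [hG : DefF A (fun v : Fin 2 → V => G (v 0) (v 1))] :
    DefF A (fun v : Fin 3 → V => recF (E (v 0) (v 1)) G (v 2)) := by
  have hE' {n} {F F' F'' F₃ : (Fin n → V) → V} [DefF A F] [DefF A F'] [DefF A F''] [DefF A F₃] :
      Def A (fun v => E (F v) (F' v) (F'' v) (F₃ v)) := Def.comp₄ E
  have hG' {n} {F F' : (Fin n → V) → V} [DefF A F] [DefF A F'] :
      DefF A (fun v => G (F v) (F' v)) := DefF.comp₂ G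
  unfold CanonicalTruth.recF IsAttempt res
  infer_instance

variable {E : V → V → Prop} {G : V → V → V}
  [hdE : Def Set.univ (fun v : Fin 2 → V => E (v 0) (v 1))]

theorem mem_res {h x p : V} : p ε res E h x ↔ p ε h ∧ ∃ z, E z x ∧ ∃ w, p = opair z w := by
  have hE' {n} {F F' : (Fin n → V) → V} [DefF Set.univ F] [DefF Set.univ F'] :
      Def Set.univ (fun v => E (F v) (F' v)) := Def.comp₂ E
  exact mem_sep

theorem res_congr {h h' x : V} (H : ∀ z, E z x → ∀ w, opair z w ε h ↔ opair z w ε h') :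
    res E h x = res E h' x := by
  refine set_ext fun p => ?_
  rw [mem_res, mem_res]
  constructor
  · rintro ⟨hp, z, hz, w, rfl⟩
    exact ⟨(H z hz w).1 hp, z, hz, w, rfl⟩
  · rintro ⟨hp, z, hz, w, rfl⟩
    exact ⟨(H z hz w).2 hp, z, hz, w, rfl⟩

/-- At `h = h'` this says that attempts are single-valued, which `IsAttempt` does not require
outright. -/
theorem IsAttempt.unique (hwf : HasInduction E) {h h' : V} (hh : IsAttempt E G h)
    (hh' : IsAttempt E G h') {x y y' : V} (hy : opair x y ε h) (hy' : opair x y' ε h') : y = y' := by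
  revert y y'
  refine hwf (fun x => ∀ {y y' : V}, opair x y ε h → opair x y' ε h' → y = y') inferInstance ?_ x
  intro x ih y y' hy hy'
  rw [(hh x y hy).1, (hh' x y' hy').1]
  refine congrArg _ (res_congr fun z hz w => ⟨fun hw => ?_, fun hw => ?_⟩)
  · obtain ⟨w', hw'⟩ := (hh' x y' hy').2 z hz
    rwa [ih z hz hw hw']
  · obtain ⟨w', hw'⟩ := (hh x y hy).2 z hz
    rwa [← ih z hz hw' hw]

/-- A union of attempts is an attempt. -/
theorem IsAttempt.sUnion (hwf : HasInduction E) {H : V} (hH : ∀ h, h ε H → IsAttempt E G h) :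
    IsAttempt E G (sUnion H) := by
  intro x y hxy
  obtain ⟨h, hh, hxy⟩ := mem_sUnion.1 hxy
  have key := hH h hh x y hxy
  refine ⟨key.1.trans (congrArg _ (res_congr fun z hz w => ⟨fun hw => ?_, fun hw => ?_⟩)),
    fun z hz => ?_⟩
  · exact mem_sUnion.2 ⟨h, hh, hw⟩
  · obtain ⟨h', hh', hw⟩ := mem_sUnion.1 hw
    obtain ⟨w', hw'⟩ := key.2 z hz
    rwa [(hH h' hh').unique hwf (hH h hh) hw hw']
  · obtain ⟨w, hw⟩ := key.2 z hz
    exact ⟨w, mem_sUnion.2 ⟨h, hh, hw⟩⟩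

/-- The intersection of all attempts that are defined at `z`. -/
noncomputable def leastAttempt (E : V → V → Prop) (G : V → V → V) (z : V) : V :=
  the fun t => ∀ q, q ε t ↔ (∃ h, IsAttempt E G h ∧ ∃ w, opair z w ε h) ∧
    ∀ h, IsAttempt E G h → (∃ w, opair z w ε h) → q ε h

/-- The new pair does not disturb the old values: domains of attempts are closed under predecessors,
so no point of the domain of `T` has `x` as a predecessor. -/
theorem IsAttempt.adjoin {T x y : V} (hT : IsAttempt E G T) (hx : ∀ w, ¬ opair x w ε T)
    (hxx : ¬ E x x) (hpred : ∀ z, E z x → ∃ w, opair z w ε T) (hy : y = G x (res E T x)) :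
    IsAttempt E G (union T (sing (opair x y))) := by
  intro x' y' h
  rw [mem_union, mem_sing, opair_inj] at h
  have key : (∀ z, E z x' → ∃ w, opair z w ε T) ∧ ¬ E x x' ∧ y' = G x' (res E T x') := by
    rcases h with h | ⟨rfl, rfl⟩
    · refine ⟨(hT _ _ h).2, fun hxx' => ?_, (hT _ _ h).1⟩
      obtain ⟨w, hw⟩ := (hT _ _ h).2 x hxx'
      exact hx w hw
    · exact ⟨hpred, hxx, hy⟩
  refine ⟨key.2.2.trans (congrArg _ (res_congr fun z hz w => ?_)), fun z hz => ?_⟩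
  · rw [mem_union, mem_sing, opair_inj]
    refine ⟨Or.inl, fun h => h.resolve_right ?_⟩
    rintro ⟨rfl, -⟩
    exact key.2.1 hz
  · obtain ⟨w, hw⟩ := key.1 z hz
    exact ⟨w, mem_union.2 (Or.inl hw)⟩

theorem recF_eq_of_mem (hwf : HasInduction E) {h x y : V} (hh : IsAttempt E G h)
    (hy : opair x y ε h) : recF E G x = y :=
  the_eq ⟨h, hh, hy⟩ fun _ ⟨_, hh', hz⟩ => hh'.unique hwf hh hz hy

variable [hdG : DefF Set.univ (fun v : Fin 2 → V => G (v 0) (v 1))]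

theorem def_isAttempt {n : ℕ} {F : (Fin n → V) → V} [DefF Set.univ F] :
    Def Set.univ (fun v => IsAttempt E G (F v)) := by
  have hE' {n} {F F' : (Fin n → V) → V} [DefF Set.univ F] [DefF Set.univ F'] :
      Def Set.univ (fun v => E (F v) (F' v)) := Def.comp₂ E
  have hG' {n} {F F' : (Fin n → V) → V} [DefF Set.univ F] [DefF Set.univ F'] :
      DefF Set.univ (fun v => G (F v) (F' v)) := DefF.comp₂ G
  have : Def Set.univ (fun v : Fin 1 → V => IsAttempt E G (v 0)) := by
    unfold IsAttempt res; infer_instance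
  exact Def.comp₁ (IsAttempt E G)

theorem mem_leastAttempt {z q : V} :
    q ε leastAttempt E G z ↔ (∃ h, IsAttempt E G h ∧ ∃ w, opair z w ε h) ∧
      ∀ h, IsAttempt E G h → (∃ w, opair z w ε h) → q ε h := by
  have h1 {n : ℕ} {F : (Fin n → V) → V} [DefF Set.univ F] := def_isAttempt (E := E) (G := G) (F := F)
  refine the_set_spec ?_ q
  by_cases h : ∃ h, IsAttempt E G h ∧ ∃ w, opair z w ε h
  · obtain ⟨h, hh, hz⟩ := h
    refine ⟨sep h fun q => ∀ h, IsAttempt E G h → (∃ w, opair z w ε h) → q ε h, fun q => ?_⟩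
    rw [mem_sep]
    exact ⟨fun hq => ⟨⟨h, hh, hz⟩, hq.2⟩, fun hq => ⟨hq.2 h hh hz, hq.2⟩⟩
  · exact ⟨emp, fun q => iff_of_false (not_mem_emp q) fun hq => h hq.1⟩

/-- Attempts agree where both are defined, so the intersection keeps all predecessors of its points.
It selects one attempt for each `z` definably, as replacement requires. -/
theorem isAttempt_leastAttempt (hwf : HasInduction E) (z : V) :
    IsAttempt E G (leastAttempt E G z) := by
  intro x y hxy
  obtain ⟨⟨h, hh, hz⟩, hall⟩ := mem_leastAttempt.1 hxy
  have key := hh x y (hall h hh hz)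
  have hmem : ∀ u w, E u x → opair u w ε h → opair u w ε leastAttempt E G z := by
    intro u w hu hw
    refine mem_leastAttempt.2 ⟨⟨h, hh, hz⟩, fun h' hh' hz' => ?_⟩
    obtain ⟨w', hw'⟩ := (hh' x y (hall h' hh' hz')).2 u hu
    rwa [hh.unique hwf hh' hw hw']
  refine ⟨key.1.trans (congrArg _ (res_congr fun u hu w => ⟨hmem u w hu, fun hw =>
    (mem_leastAttempt.1 hw).2 h hh hz⟩)), fun u hu => ?_⟩
  obtain ⟨w, hw⟩ := key.2 u hu
  exact ⟨w, hmem u w hu hw⟩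

/-- The union of the least attempts at the predecessors of `x` is an attempt, to which a value at
`x` is adjoined. -/
theorem exists_attempt (hwf : HasInduction E) (hs : SetLike E) (x : V) :
    ∃ h, IsAttempt E G h ∧ ∃ y, opair x y ε h := by
  have hA {n : ℕ} {F : (Fin n → V) → V} [DefF Set.univ F] := def_isAttempt (E := E) (G := G) (F := F)
  refine hwf (fun x => ∃ h, IsAttempt E G h ∧ ∃ y, opair x y ε h) inferInstance (fun x ih => ?_) x
  have hl : DefF Set.univ (fun v : Fin 1 → V => leastAttempt E G (v 0)) := by
    unfold leastAttempt; infer_instance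
  have hT : IsAttempt E G (sUnion (img (ext E x) (leastAttempt E G))) := by
    refine IsAttempt.sUnion hwf fun h hh => ?_
    obtain ⟨z, -, rfl⟩ := mem_img.1 hh
    exact isAttempt_leastAttempt hwf z
  -- If the union already has a value at `x`, nothing remains to be done; the case split makes it
  -- unnecessary to exclude this.
  by_cases hx : ∃ w, opair x w ε sUnion (img (ext E x) (leastAttempt E G))
  · exact ⟨_, hT, hx⟩
  · refine ⟨_, hT.adjoin (not_exists.1 hx) (hwf.irrefl x) (fun z hz => ?_) rfl,
      _, mem_union.2 (Or.inr (mem_sing.2 rfl))⟩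
    obtain ⟨h, hh, w, hw⟩ := ih z hz
    refine ⟨w, mem_sUnion.2 ⟨_, mem_img.2 ⟨z, hs.mem_ext.2 hz, rfl⟩, mem_leastAttempt.2
      ⟨⟨h, hh, w, hw⟩, fun h' hh' hz' => ?_⟩⟩⟩
    obtain ⟨w', hw'⟩ := hz'
    rwa [hh.unique hwf hh' hw hw']

theorem defF_recF : DefF Set.univ (fun v : Fin 1 → V => recF E G (v 0)) := by
  have hA {n : ℕ} {F : (Fin n → V) → V} [DefF Set.univ F] := def_isAttempt (E := E) (G := G) (F := F)
  unfold recF; infer_instance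

theorem recF_eq (hwf : HasInduction E) (hs : SetLike E) (x : V) :
    recF E G x = G x (lam (ext E x) (recF E G)) := by
  have := defF_recF (E := E) (G := G)
  obtain ⟨h, hh, y, hy⟩ := exists_attempt (G := G) hwf hs x
  rw [recF_eq_of_mem hwf hh hy, (hh x y hy).1]
  refine congrArg _ (set_ext fun p => ?_)
  rw [mem_res, mem_lam]
  constructor
  · rintro ⟨hp, z, hz, w, rfl⟩
    exact ⟨z, hs.mem_ext.2 hz, by rw [recF_eq_of_mem hwf hh hp]⟩
  · rintro ⟨z, hz, rfl⟩
    rw [hs.mem_ext] at hz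
    obtain ⟨w, hw⟩ := (hh x y hy).2 z hz
    rw [recF_eq_of_mem hwf hh hw]
    exact ⟨hw, z, hz, w, rfl⟩

end Recursion

/-! ### Closures, rank, collection and choice functions -/

section Rank

variable {V : Type u} [LSet.Structure V]

theorem setLike_mem : SetLike (SMem (V := V)) := fun x => ⟨x, fun _ => Iff.rfl⟩

variable [ZFCModel V]

/-- The membership relation below ordinals. -/
def MemOrd (y x : V) : Prop := y ε x ∧ Ord x

instance Def.memOrd {A : Set V} {n : ℕ} {F G : (Fin n → V) → V} [DefF A F] [DefF A G] :
    Def A (fun v => MemOrd (F v) (G v)) := by unfold MemOrd; infer_instance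

theorem setLike_memOrd : SetLike (MemOrd (V := V)) := by
  intro x
  by_cases h : Ord x
  · exact ⟨x, fun y => by simp [MemOrd, h]⟩
  · exact ⟨emp, fun y => by simp [MemOrd, h]⟩

theorem ext_memOrd {x : V} (hx : Ord x) : ext MemOrd x = x :=
  set_ext fun z => by simp [setLike_memOrd.mem_ext, MemOrd, hx]

theorem hasInduction_memOrd : HasInduction (MemOrd (V := V)) := by
  intro P hP h x
  by_cases hx : Ord x
  · exact Ord.induction (fun x _ ih => h x fun y hy => ih y hy.1) hx
  · exact h x fun y hy => (hx hy.2).elim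

theorem img_congr {a : V} {F G : V → V} (h : ∀ x, x ε a → F x = G x) : img a F = img a G := by
  unfold img
  congr 1
  funext b
  refine propext (forall_congr' fun y => iff_congr Iff.rfl (exists_congr fun x =>
    and_congr_right fun hx => ?_))
  rw [h x hx]

theorem img_app_lam {a : V} {F : V → V} [hF : DefF Set.univ (fun v : Fin 1 → V => F (v 0))] :
    img a (app (lam a F)) = img a F := img_congr fun _ => app_lam

/-- Every set belongs to a set that is closed under `E`-predecessors. -/
theorem SetLike.exists_closure (hlim : ∃ w : V, IsLim w) {E : V → V → Prop}
    [hdE : Def Set.univ (fun v : Fin 2 → V => E (v 0) (v 1))] (hE : SetLike E) (x : V) :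
    ∃ C, x ε C ∧ ∀ y, y ε C → ∀ z, E z y → z ε C := by
  have hE' {n} {F F' : (Fin n → V) → V} [DefF Set.univ F] [DefF Set.univ F'] :
      Def Set.univ (fun v => E (F v) (F' v)) := Def.comp₂ E
  have hext : DefF Set.univ (fun v : Fin 1 → V => ext E (v 0)) := by unfold ext; infer_instance
  have hext' {n} {F : (Fin n → V) → V} [DefF Set.univ F] : DefF Set.univ (fun v => ext E (F v)) :=
    DefF.comp₁ _
  obtain ⟨w, hw⟩ := hlim
  -- Stage `n` consists of `x` and all `E`-predecessors of elements of earlier stages. The union of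
  -- the stages below a limit ordinal is closed.
  let G : V → V → V := fun n h =>
    union (sing x) (CanonicalTruth.sUnion (img (CanonicalTruth.sUnion (img n (app h))) (ext E)))
  have hG : DefF Set.univ (fun v : Fin 2 → V => G (v 0) (v 1)) := by
    unfold G; infer_instance
  have hH := defF_recF (E := MemOrd) (G := G)
  have hrec : ∀ n, Ord n → ∀ z, z ε recF MemOrd G n ↔
      z = x ∨ ∃ m, m ε n ∧ ∃ y, y ε recF MemOrd G m ∧ E z y := by
    intro n hn z
    rw [recF_eq hasInduction_memOrd setLike_memOrd, ext_memOrd hn]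
    simp only [G, img_app_lam, mem_union, mem_sing, mem_sUnion, mem_img]
    refine or_congr Iff.rfl ⟨?_, ?_⟩
    · rintro ⟨_, ⟨y, ⟨_, ⟨m, hm, rfl⟩, hy⟩, rfl⟩, hz⟩
      exact ⟨m, hm, y, hy, hE.mem_ext.1 hz⟩
    · rintro ⟨m, hm, y, hy, hz⟩
      exact ⟨_, ⟨y, ⟨_, ⟨m, hm, rfl⟩, hy⟩, rfl⟩, hE.mem_ext.2 hz⟩
  refine ⟨CanonicalTruth.sUnion (img w (recF MemOrd G)), ?_, ?_⟩
  · obtain ⟨n, hn⟩ := hw.1.2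
    exact mem_sUnion.2 ⟨_, mem_img.2 ⟨n, hn, rfl⟩, (hrec n (hw.1.1.of_mem hn) x).2 (Or.inl rfl)⟩
  · intro y hy z hz
    obtain ⟨_, h, hy⟩ := mem_sUnion.1 hy
    obtain ⟨n, hn, rfl⟩ := mem_img.1 h
    exact mem_sUnion.2 ⟨_, mem_img.2 ⟨succ n, hw.succ_mem hn, rfl⟩,
      (hrec _ (hw.1.1.of_mem hn).succ z).2 (Or.inr ⟨n, mem_succ.2 (Or.inr rfl), y, hy, hz⟩)⟩

/-- Minimal elements are assumed for sets only. A counterexample is placed in a set `C` closed under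
predecessors, and a minimal counterexample within `C` is then minimal outright. -/
theorem SetLike.hasInduction (hlim : ∃ w : V, IsLim w) {E : V → V → Prop}
    [hdE : Def Set.univ (fun v : Fin 2 → V => E (v 0) (v 1))] (hE : SetLike E)
    (h : ∀ s x : V, x ε s → ∃ y, y ε s ∧ ∀ z, z ε s → ¬ E z y) : HasInduction E := by
  intro P hP hind x
  by_contra hx
  have hP' {n} {F : (Fin n → V) → V} [DefF Set.univ F] : Def Set.univ (fun v => P (F v)) :=
    Def.comp₁ P
  obtain ⟨C, hxC, hC⟩ := hE.exists_closure hlim x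
  obtain ⟨y, hy, hy'⟩ := h (sep C fun y => ¬ P y) x (mem_sep.2 ⟨hxC, hx⟩)
  rw [mem_sep] at hy
  refine hy.2 (hind y fun z hz => ?_)
  by_contra hz'
  exact hy' z (mem_sep.2 ⟨hC y hy.1 z hz, hz'⟩) hz

theorem ext_mem (x : V) : ext SMem x = x := set_ext fun _ => setLike_mem.mem_ext

theorem hasInduction_mem (hlim : ∃ w : V, IsLim w) : HasInduction (SMem (V := V)) :=
  setLike_mem.hasInduction hlim fun _ _ => exists_min_of_mem

/-- The rank of a set. -/
noncomputable def rank : V → V :=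
  recF SMem fun x h => sUnion (img x fun y => succ (app h y))

instance DefF.rank {A : Set V} {n : ℕ} {F : (Fin n → V) → V} [DefF A F] :
    DefF A (fun v => rank (F v)) := by
  have h := DefF.recF (A := A) (fun _ _ : V => SMem) (fun x h => CanonicalTruth.sUnion
    (CanonicalTruth.img x fun y => CanonicalTruth.succ (CanonicalTruth.app h y)))
  have : DefF A (fun v : Fin 1 → V => CanonicalTruth.rank (v 0)) := h.rename (fun _ => 0)
  exact DefF.comp₁ _

variable (hlim : ∃ w : V, IsLim w)
include hlim

theorem mem_rank {x z : V} : z ε rank x ↔ ∃ y, y ε x ∧ z ε succ (rank y) := by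
  have hr : DefF Set.univ (fun v : Fin 1 → V => recF SMem
    (fun x h : V => sUnion (img x fun y => succ (app h y))) (v 0)) := defF_recF
  rw [rank, recF_eq (hasInduction_mem hlim) setLike_mem, ext_mem, mem_sUnion, ← rank]
  simp only [mem_img]
  have : DefF Set.univ (fun v : Fin 1 → V => rank (v 0)) := inferInstance
  constructor
  · rintro ⟨_, ⟨y, hy, rfl⟩, hz⟩
    rw [app_lam hy] at hz
    exact ⟨y, hy, hz⟩
  · rintro ⟨y, hy, hz⟩
    exact ⟨_, ⟨y, hy, rfl⟩, by rwa [app_lam hy]⟩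

theorem rank_mem_rank {x y : V} (h : y ε x) : rank y ε rank x :=
  (mem_rank hlim).2 ⟨y, h, mem_succ.2 (Or.inr rfl)⟩

theorem ord_rank (x : V) : Ord (rank x) := by
  refine hasInduction_mem hlim (fun x => Ord (rank x)) inferInstance (fun x ih => ?_) x
  have : rank x = sUnion (img x fun y => succ (rank y)) := by
    refine set_ext fun z => ?_
    rw [mem_rank hlim, mem_sUnion]
    constructor
    · rintro ⟨y, hy, hz⟩
      exact ⟨_, mem_img.2 ⟨y, hy, rfl⟩, hz⟩
    · rintro ⟨t, ht, hz⟩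
      obtain ⟨y, hy, rfl⟩ := mem_img.1 ht
      exact ⟨y, hy, hz⟩
  rw [this]
  refine Ord.sUnion fun z hz => ?_
  obtain ⟨y, hy, rfl⟩ := mem_img.1 hz
  exact (ih y hy).succ

theorem exists_level {a : V} (ha : Ord a) : ∃ s, ∀ z, z ε s ↔ rank z ε a := by
  refine Ord.induction (P := fun a => ∃ s, ∀ z, z ε s ↔ rank z ε a) (fun a ha ih => ?_) ha
  let level : V → V := fun b => the fun s => ∀ z, z ε s ↔ rank z ε b
  have hl : DefF Set.univ (fun v : Fin 1 → V => level (v 0)) := by unfold level; infer_instance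
  -- A set of rank `b` is a subset of the level of index `b`, because its elements have smaller
  -- rank.
  refine ⟨sep (sUnion (img a fun b => powset (level b))) fun z => rank z ε a, fun z => ?_⟩
  have hl' {n} {F : (Fin n → V) → V} [DefF Set.univ F] : DefF Set.univ (fun v => level (F v)) :=
    DefF.comp₁ _
  rw [mem_sep, mem_sUnion, and_iff_right_of_imp]
  intro hz
  refine ⟨_, mem_img.2 ⟨rank z, hz, rfl⟩, mem_powset.2 fun y hy => ?_⟩
  exact (the_set_spec (ih _ hz) y).2 (rank_mem_rank hlim hy)

/-- A set whose elements have bounded ranks is covered by a level of the hierarchy. -/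
theorem exists_bound {R : V} (hR : ∀ b, b ε R → Ord b) : ∃ s, ∀ z, rank z ε R → z ε s := by
  obtain ⟨s, hs⟩ := exists_level hlim (Ord.sUnion hR).succ
  refine ⟨s, fun z hz => (hs z).2 (mem_succ.2 ?_)⟩
  exact (hR _ hz).mem_or_eq_of_sub (Ord.sUnion hR) fun y hy => mem_sUnion.2 ⟨_, hz, hy⟩

/-- Scott's trick: replacement is applied to the least rank of a witness, which is unique, and one
level of the hierarchy covers all these ranks. -/
theorem exists_collection (a : V) (R : V → V → Prop)
    [hR : Def Set.univ (fun v : Fin 2 → V => R (v 0) (v 1))] (h : ∀ x, x ε a → ∃ y, R x y) :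
    ∃ b, ∀ x, x ε a → ∃ y, y ε b ∧ R x y := by
  have hR' {n} {F F' : (Fin n → V) → V} [DefF Set.univ F] [DefF Set.univ F'] :
      Def Set.univ (fun v => R (F v) (F' v)) := Def.comp₂ R
  let P : V → V → Prop := fun x b => (∃ y, R x y ∧ rank y = b) ∧ ∀ y, R x y → Sub b (rank y)
  have hP : ∀ x, x ε a → P x (the (P x)) := by
    intro x hx
    refine the_spec ?_ ?_
    · obtain ⟨y, hy⟩ := h x hx
      obtain ⟨b, hb, ⟨y', hy', rfl⟩, hb'⟩ := Ord.exists_least (P := fun b => ∃ y, R x y ∧ rank y = b)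
        (ord_rank hlim y) ⟨y, hy, rfl⟩
      refine ⟨_, ⟨y', hy', rfl⟩, fun y'' hy'' => ?_⟩
      exact hb.sub_of_not_mem (ord_rank hlim _) fun hc => hb' _ hc ⟨y'', hy'', rfl⟩
    · rintro b b' ⟨⟨y, hy, rfl⟩, hb⟩ ⟨⟨y', hy', rfl⟩, hb'⟩
      exact set_ext fun z => ⟨hb y' hy' z, hb' y hy z⟩
  have hdP : DefF Set.univ (fun v : Fin 1 → V => the (P (v 0))) := by unfold P; infer_instance
  obtain ⟨s, hs⟩ := exists_bound hlim (R := img a fun x => the (P x)) (by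
    intro b hb
    obtain ⟨x, hx, rfl⟩ := mem_img.1 hb
    obtain ⟨⟨y, -, hy⟩, -⟩ := hP x hx
    rw [← hy]
    exact ord_rank hlim y)
  refine ⟨s, fun x hx => ?_⟩
  obtain ⟨⟨y, hy, hy'⟩, -⟩ := hP x hx
  exact ⟨y, hs y (mem_img.2 ⟨x, hx, hy'⟩), hy⟩

/-- Choice functions for definable relations. -/
theorem exists_choice_function (a : V) (R : V → V → Prop)
    [hR : Def Set.univ (fun v : Fin 2 → V => R (v 0) (v 1))] (h : ∀ x, x ε a → ∃ y, R x y) :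
    ∃ g, IsFun g a ∧ ∀ x, x ε a → R x (app g x) := by
  have hR' {n} {F F' : (Fin n → V) → V} [DefF Set.univ F] [DefF Set.univ F'] :
      Def Set.univ (fun v => R (F v) (F' v)) := Def.comp₂ R
  obtain ⟨b, hb⟩ := exists_collection hlim a R h
  -- Tagging the witnesses with `x` makes these sets disjoint for different `x`, as the transversal
  -- form of choice requires.
  let B : V → V := fun x => img (sep b (R x)) (opair x)
  have hdB : DefF Set.univ (fun v : Fin 1 → V => B (v 0)) := by unfold B; infer_instance
  have hB : ∀ x p, p ε B x ↔ ∃ y, (y ε b ∧ R x y) ∧ p = opair x y := by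
    intro x p
    simp only [B, mem_img, mem_sep]
  obtain ⟨c, hc⟩ := exists_transversal (img a B) (by
    intro y hy
    obtain ⟨x, hx, rfl⟩ := mem_img.1 hy
    obtain ⟨y, hy⟩ := hb x hx
    exact ⟨_, (hB x _).2 ⟨y, hy, rfl⟩⟩) (by
    intro y hy y' hy' z hz hz'
    obtain ⟨x, hx, rfl⟩ := mem_img.1 hy
    obtain ⟨x', hx', rfl⟩ := mem_img.1 hy'
    obtain ⟨y, -, rfl⟩ := (hB x _).1 hz
    obtain ⟨y', -, h⟩ := (hB x' _).1 hz'
    rw [(opair_inj.1 h).1])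
  let g : V := sep (sUnion (img a B)) fun p => p ε c
  have hg : ∀ p, p ε g ↔ (∃ x, x ε a ∧ p ε B x) ∧ p ε c := by
    intro p
    simp only [g, mem_sep, mem_sUnion, mem_img]
    refine and_congr_left fun _ => ⟨?_, ?_⟩
    · rintro ⟨_, ⟨x, hx, rfl⟩, hp⟩; exact ⟨x, hx, hp⟩
    · rintro ⟨x, hx, hp⟩; exact ⟨_, ⟨x, hx, rfl⟩, hp⟩
  have hfun : IsFun g a := by
    refine isFun_iff.2 ⟨fun p hp => ?_, fun x hx => ?_⟩
    · obtain ⟨⟨x, hx, hp⟩, -⟩ := (hg p).1 hp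
      obtain ⟨y, -, rfl⟩ := (hB x p).1 hp
      exact ⟨x, hx, y, rfl⟩
    · obtain ⟨z, hz⟩ := hc _ (mem_img.2 ⟨x, hx, rfl⟩)
      obtain ⟨h1, h2⟩ := (hz z).2 rfl
      obtain ⟨y, hy, rfl⟩ := (hB x z).1 h1
      refine ⟨y, (hg _).2 ⟨⟨x, hx, h1⟩, h2⟩, fun y' hy' => ?_⟩
      obtain ⟨⟨x', hx', h3⟩, h4⟩ := (hg _).1 hy'
      obtain ⟨y'', hy'', h5⟩ := (hB x' _).1 h3
      obtain ⟨rfl, rfl⟩ := opair_inj.1 h5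
      exact (opair_inj.1 ((hz _).1 ⟨h3, h4⟩)).2
  refine ⟨g, hfun, fun x hx => ?_⟩
  obtain ⟨⟨x', hx', h3⟩, h4⟩ := (hg _).1 (hfun.app_mem hx)
  obtain ⟨y'', hy'', h5⟩ := (hB x' _).1 h3
  obtain ⟨rfl, h6⟩ := opair_inj.1 h5
  rw [h6]
  exact hy''.2

end Rank

/-! ### The ultrapower by a measure -/

section Big

variable {V : Type u} [LSet.Structure V]

/-- `u` is a nonprincipal `k`-complete ultrafilter on the uncountable cardinal `k`. -/
def IsMeasure (k u : V) : Prop :=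
  Formula.Realize (measureF (fv 0) (fv 1) : LSet.Formula (Fin 2)) ![k, u]

instance Def.isMeasure {A : Set V} {n : ℕ} {F G : (Fin n → V) → V} [DefF A F] [DefF A G] :
    Def A (fun v => IsMeasure (F v) (G v)) :=
  have : Def A (fun v : Fin 2 → V => IsMeasure (v 0) (v 1)) :=
    (Def.formula (measureF (fv 0) (fv 1) : LSet.Formula (Fin 2))).congr fun v => by
      rw [IsMeasure]
      refine iff_of_eq (congrArg _ ?_)
      funext i; fin_cases i <;> rfl
  Def.comp₂ IsMeasure

theorem realize_measureF {α : Type} {n : ℕ} {v : α → V} {xs : Fin n → V} (x y : Var α n) :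
    (measureF x y).Realize v xs ↔ IsMeasure (val v xs x) (val v xs y) := by
  simp [IsMeasure, measureF, uncountableCardF, cardF, ultrafilterF, nonprincipalF, completeF,
    Formula.Realize]

/-- The set of all `i ∈ k` with `P i` belongs to `u`. -/
def Big (k u : V) (P : V → Prop) : Prop := ∃ a, a ε u ∧ ∀ i, i ε a ↔ i ε k ∧ P i

instance Def.big {A : Set V} {n : ℕ} {F G : (Fin n → V) → V} {P : (Fin n → V) → V → Prop}
    [hF : DefF A F] [hG : DefF A G]
    [hP : Def A (fun w : Fin (n + 1) → V => P (fun i => w i.castSucc) (w (Fin.last n)))] :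
    Def A (fun v => Big (F v) (G v) (P v)) := by
  have h1 (m : ℕ) (σ : Fin n → Fin m) (j : Fin m) := hP.rename_snoc σ j
  have h2 (m : ℕ) (σ : Fin n → Fin m) := hF.rename σ
  have h3 (m : ℕ) (σ : Fin n → Fin m) := hG.rename σ
  unfold Big
  infer_instance

/-- The defining properties of a measure on `k`. -/
structure MeasureSpec (k u : V) : Prop where
  ord : Ord k
  exists_lim : ∃ w, w ε k ∧ IsLim w
  top_mem : k ε u
  nonempty : ∀ x, x ε u → ∃ i, i ε x
  upward : ∀ x, x ε u → ∀ y, Sub x y → Sub y k → y ε u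
  inter : ∀ x, x ε u → ∀ y, y ε u → ∃ z, z ε u ∧ ∀ t, t ε z ↔ t ε x ∧ t ε y
  ultra : ∀ x, Sub x k → x ε u ∨ ∃ y, y ε u ∧ ∀ t, t ε y ↔ t ε k ∧ ¬ t ε x
  nonprincipal : ∀ x, x ε u → ¬ ∃ t, IsPair x t t
  complete : ∀ c, c ε k → ∀ f, IsFun f c → (∀ i, i ε c → ∃ x, x ε u ∧ IsApp f i x) →
    ∃ b, b ε u ∧ ∀ t, t ε b ↔ t ε k ∧ ∀ i, i ε c → ∀ x, IsApp f i x → t ε x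

theorem IsMeasure.spec {k u : V} (h : IsMeasure k u) : MeasureSpec k u := by
  simp [IsMeasure, measureF, uncountableCardF, cardF, ultrafilterF, nonprincipalF, completeF,
    Formula.Realize] at h
  obtain ⟨⟨⟨⟨⟨h1, -⟩, h2⟩, ⟨⟨⟨⟨⟨-, h4⟩, h5⟩, h6⟩, h7⟩, h8⟩⟩, h9⟩, h10⟩ := h
  exact ⟨h1, h2, h4, h5, h6, h7, h8, fun x hx ⟨t, ht⟩ => h9 x hx t ht, h10⟩

variable {k u : V}

theorem Big.and {P Q : V → Prop} (hm : IsMeasure k u) (hP : Big k u P) (hQ : Big k u Q) :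
    Big k u (fun i => P i ∧ Q i) := by
  obtain ⟨a, ha, ha'⟩ := hP
  obtain ⟨b, hb, hb'⟩ := hQ
  obtain ⟨c, hc, hc'⟩ := hm.spec.inter a ha b hb
  refine ⟨c, hc, fun i => ?_⟩
  rw [hc', ha', hb']
  tauto

theorem Big.exists {P : V → Prop} (hm : IsMeasure k u) (hP : Big k u P) : ∃ i, i ε k ∧ P i := by
  obtain ⟨a, ha, ha'⟩ := hP
  obtain ⟨i, hi⟩ := hm.spec.nonempty a ha
  exact ⟨i, (ha' i).1 hi⟩

theorem Big.of_forall {P : V → Prop} (hm : IsMeasure k u) (h : ∀ i, i ε k → P i) : Big k u P :=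
  ⟨k, hm.spec.top_mem, fun i => ⟨fun hi => ⟨hi, h i hi⟩, And.left⟩⟩

theorem IsMeasure.exists_lim (hm : IsMeasure k u) : ∃ w : V, IsLim w :=
  let ⟨w, _, hw⟩ := hm.spec.exists_lim; ⟨w, hw⟩

variable [ZFCModel V]

/-- `Big` asserts that the set of good indices exists, so upward closure needs `Q` to be definable.
-/
theorem Big.mono {P Q : V → Prop} [hQ : Def Set.univ (fun v : Fin 1 → V => Q (v 0))]
    (hm : IsMeasure k u) (hP : Big k u P) (h : ∀ i, i ε k → P i → Q i) : Big k u Q := by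
  obtain ⟨a, ha, ha'⟩ := hP
  refine ⟨sep k Q, hm.spec.upward a ha _ (fun i hi => ?_) (fun i hi => (mem_sep.1 hi).1),
    fun i => mem_sep⟩
  exact mem_sep.2 ⟨((ha' i).1 hi).1, h i ((ha' i).1 hi).1 ((ha' i).1 hi).2⟩

theorem Big.mono₂ {P P' Q : V → Prop} [hQ : Def Set.univ (fun v : Fin 1 → V => Q (v 0))]
    (hm : IsMeasure k u) (hP : Big k u P) (hP' : Big k u P')
    (h : ∀ i, i ε k → P i → P' i → Q i) : Big k u Q :=
  (hP.and hm hP').mono hm fun i hi hp => h i hi hp.1 hp.2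

theorem big_not {P : V → Prop} [hP : Def Set.univ (fun v : Fin 1 → V => P (v 0))]
    (hm : IsMeasure k u) : Big k u (fun i => ¬ P i) ↔ ¬ Big k u P := by
  constructor
  · intro h h'
    obtain ⟨i, -, h1, h2⟩ := (h.and hm h').exists hm
    exact h1 h2
  · intro h
    rcases hm.spec.ultra (sep k P) fun i hi => (mem_sep.1 hi).1 with h' | ⟨y, hy, hy'⟩
    · exact (h ⟨_, h', fun i => mem_sep⟩).elim
    · refine ⟨y, hy, fun i => ?_⟩
      rw [hy', mem_sep]
      tauto

/-- This is `k`-completeness, applied to the sequence of the sets cut out by the `P j`. -/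
theorem Big.all {P : V → V → Prop} [hP : Def Set.univ (fun v : Fin 2 → V => P (v 0) (v 1))]
    (hm : IsMeasure k u) {c : V} (hc : c ε k) (h : ∀ j, j ε c → Big k u (P j)) :
    Big k u (fun i => ∀ j, j ε c → P j i) := by
  have hP' {n} {F F' : (Fin n → V) → V} [DefF Set.univ F] [DefF Set.univ F'] :
      Def Set.univ (fun v => P (F v) (F' v)) := Def.comp₂ P
  have hmem : ∀ j, j ε c → sep k (P j) ε u := by
    intro j hj
    obtain ⟨a, ha, ha'⟩ := h j hj
    rwa [show sep k (P j) = a from set_ext fun i => mem_sep.trans (ha' i).symm]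
  have hd : DefF Set.univ (fun v : Fin 1 → V => sep k (P (v 0))) := inferInstance
  obtain ⟨b, hb, hb'⟩ := hm.spec.complete c hc (lam c fun j => sep k (P j)) isFun_lam
    fun j hj => ⟨_, hmem j hj, isApp_iff.2 (opair_mem_lam.2 ⟨hj, rfl⟩)⟩
  refine ⟨b, hb, fun i => (hb' i).trans (and_congr_right fun hi => forall₂_congr fun j hj => ?_)⟩
  simp only [isApp_iff, opair_mem_lam, hj, true_and, forall_eq, mem_sep, hi]

/-- Otherwise the set of `i ∈ k` with `i = a` would be in `u`; being nonempty, it would be a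
singleton. -/
theorem big_ne (hm : IsMeasure k u) (a : V) : Big k u (fun i => i ≠ a) := by
  refine (big_not (P := fun i => i = a) hm).2 ?_
  rintro ⟨x, hx, hx'⟩
  obtain ⟨i, hi⟩ := hm.spec.nonempty x hx
  obtain ⟨hi, rfl⟩ := (hx' i).1 hi
  refine hm.spec.nonprincipal x hx ⟨i, fun j => (hx' j).trans ?_⟩
  simp only [or_self, and_iff_right_iff_imp]
  rintro rfl; exact hi

end Big

/-! ### Well-foundedness and collapse of the ultrapower -/

section Ultrapower

variable {V : Type u} [LSet.Structure V] [ZFCModel V] {k u : V}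

/-- Membership of functions on `k` modulo `u`, restricted to functions `g` with
`g i ∈ f i ∪ {∅}`. -/
def UltMem (k u g f : V) : Prop :=
  (IsFun g k ∧ IsFun f k) ∧ Big k u (fun i => app g i ε app f i) ∧
    ∀ i, i ε k → app g i ε app f i ∨ app g i = emp

instance Def.ultMem {A : Set V} {n : ℕ} {F G H K : (Fin n → V) → V} [DefF A F] [DefF A G]
    [DefF A H] [DefF A K] : Def A (fun v => UltMem (F v) (G v) (H v) (K v)) :=
  have : Def A (fun v : Fin 4 → V => UltMem (v 0) (v 1) (v 2) (v 3)) := by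
    unfold UltMem; infer_instance
  Def.comp₄ UltMem

/-- The pointwise clause of `UltMem` bounds `g` by the product of `k` with `{∅} ∪ ⋃ f(i)`. Without
it the values of `g` off a set in `u` would be arbitrary, and the predecessors would not form a set.
-/
theorem setLike_ultMem (k u : V) : SetLike (UltMem k u) := by
  intro f
  refine ⟨sep (powset (prod k (union (sing emp) (sUnion (img k (app f))))))
    fun g => UltMem k u g f, fun g => ?_⟩
  rw [mem_sep, and_iff_right_of_imp]
  intro h
  refine mem_powset.2 fun p hp => ?_
  obtain ⟨i, hi, y, rfl⟩ := (isFun_iff.1 h.1.1).1 p hp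
  refine mem_prod.2 ⟨i, hi, y, ?_, rfl⟩
  have h1 := h.2.2 i hi
  rw [h.1.1.app_eq hp] at h1
  rw [mem_union, mem_sing, mem_sUnion]
  exact h1.symm.imp_right fun h2 => ⟨_, mem_img.2 ⟨i, hi, rfl⟩, h2⟩

/-- The recursion step of the iteration of the function `c`, starting with `x`. -/
noncomputable def iterateStep (c x n h : V) : V :=
  the fun y => (sUnion n ε n ∧ y = app c (app h (sUnion n))) ∨ (¬ sUnion n ε n ∧ y = x)

/-- The iteration of the function `c`, starting with `x`. -/
noncomputable def iterate (c x n : V) : V := recF MemOrd (iterateStep c x) n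

theorem defF_iterateStep (c x : V) :
    DefF Set.univ (fun v : Fin 2 → V => iterateStep c x (v 0) (v 1)) := by
  unfold iterateStep; infer_instance

theorem defF_iterate (c x : V) : DefF Set.univ (fun v : Fin 1 → V => iterate c x (v 0)) :=
  have := defF_iterateStep c x
  defF_recF

/-- For an ordinal `n`, the condition `⋃ n ∈ n` says that `n` is a successor. At zero and at limits
the iteration restarts at `x`, which does no harm since only successor steps are compared. -/
theorem iterate_eq (c x : V) {n : V} (hn : Ord n) :
    (sUnion n ε n → iterate c x n = app c (iterate c x (sUnion n))) ∧
    (¬ sUnion n ε n → iterate c x n = x) := by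
  have hd := defF_iterate c x
  have hd' := defF_iterateStep c x
  have h := recF_eq (G := iterateStep c x) hasInduction_memOrd setLike_memOrd n
  rw [ext_memOrd hn] at h
  constructor
  · intro h1
    rw [iterate, h]
    refine (the_eq (y := app c (iterate c x (sUnion n))) (Or.inl ⟨h1, ?_⟩) ?_)
    · exact congrArg _ (app_lam (F := iterate c x) h1).symm
    · rintro z (⟨-, rfl⟩ | h2)
      · exact congrArg _ (app_lam (F := iterate c x) h1)
      · exact (h2.1 h1).elim
  · intro h1
    rw [iterate, h]
    refine the_eq (Or.inr ⟨h1, rfl⟩) ?_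
    rintro z (h2 | ⟨-, rfl⟩)
    · exact (h1 h2.1).elim
    · rfl

theorem iterate_succ (c x : V) {n : V} (hn : Ord n) :
    iterate c x (succ n) = app c (iterate c x n) := by
  have h := (iterate_eq c x hn.succ).1
  rw [sUnion_succ hn] at h
  exact h (mem_succ.2 (Or.inr rfl))

/-- A set `s` without minimal element has a function `c` choosing predecessors within `s`. Its
iterates descend at almost every index, for each `n ∈ w`. As `w < k`, completeness gives one index
`i` at which all these descents occur, and the values at `i` form a set without `∈`-minimal element.
-/
theorem hasInduction_ultMem (hm : IsMeasure k u) : HasInduction (UltMem k u) := by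
  refine (setLike_ultMem k u).hasInduction hm.exists_lim fun s x hx => ?_
  by_contra! hs
  obtain ⟨c, -, hc⟩ := exists_choice_function hm.exists_lim s
    (fun y z => z ε s ∧ UltMem k u z y) hs
  obtain ⟨w, hwk, hw⟩ := hm.spec.exists_lim
  have hd := defF_iterate c x
  have hd' {n} {F : (Fin n → V) → V} [DefF Set.univ F] :
      DefF Set.univ (fun v => iterate c x (F v)) := DefF.comp₁ _
  have hmem : ∀ n, Ord n → iterate c x n ε s := by
    intro n hn
    refine Ord.induction (P := fun n => iterate c x n ε s) (fun n hn ih => ?_) hn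
    by_cases h : sUnion n ε n
    · rw [(iterate_eq c x hn).1 h]
      exact (hc _ (ih _ h)).1
    · rwa [(iterate_eq c x hn).2 h]
  have hbig := Big.all (P := fun n i => app (iterate c x (succ n)) i ε app (iterate c x n) i) hm hwk
    (fun n hn => by
      have hn' := hw.1.1.of_mem hn
      rw [iterate_succ c x hn']
      exact (hc _ (hmem n hn')).2.2.1)
  obtain ⟨i, hi, hi'⟩ := hbig.exists hm
  obtain ⟨n, hn⟩ := hw.1.2
  obtain ⟨y, hy, hy'⟩ := exists_min_of_mem (mem_img.2 ⟨n, hn, rfl⟩ :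
    app (iterate c x n) i ε img w fun n => app (iterate c x n) i)
  obtain ⟨m, hm, rfl⟩ := mem_img.1 hy
  exact hy' _ (mem_img.2 ⟨_, hw.succ_mem hm, rfl⟩) (hi' m hm)

/-- The range of a function. -/
noncomputable def ran (h : V) : V := the fun r => ∀ y, y ε r ↔ ∃ x, opair x y ε h

theorem ran_lam {a : V} {F : V → V} [hF : DefF Set.univ (fun v : Fin 1 → V => F (v 0))] :
    ran (lam a F) = img a F := by
  have h : ∀ y, y ε img a F ↔ ∃ x, opair x y ε lam a F := fun y => by
    simp only [mem_img, opair_mem_lam]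
  exact set_ext fun y => (the_set_spec ⟨_, h⟩ y).trans (h y).symm

/-- The transitive collapse of the ultrapower by `u`, as a function on the functions on `k`. -/
noncomputable def coll (k u f : V) : V := recF (UltMem k u) (fun _ h => ran h) f

instance DefF.coll {A : Set V} {n : ℕ} {F G H : (Fin n → V) → V} [DefF A F] [DefF A G]
    [DefF A H] : DefF A (fun v => coll (F v) (G v) (H v)) := by
  have hr : DefF A (fun v : Fin 2 → V => ran (v 1)) := by unfold ran; infer_instance
  have : DefF A (fun v : Fin 3 → V => CanonicalTruth.coll (v 0) (v 1) (v 2)) :=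
    DefF.recF UltMem fun _ h => ran h
  exact DefF.comp₃ CanonicalTruth.coll

theorem mem_coll (hm : IsMeasure k u) {f z : V} :
    z ε coll k u f ↔ ∃ g, UltMem k u g f ∧ z = coll k u g := by
  have hr : DefF Set.univ (fun v : Fin 2 → V => ran (v 1)) := by unfold ran; infer_instance
  have hc : DefF Set.univ (fun v : Fin 1 → V => coll k u (v 0)) := inferInstance
  have h := recF_eq (G := fun _ h => ran h) (hasInduction_ultMem hm) (setLike_ultMem k u) f
  rw [coll, h]
  refine Iff.trans (iff_of_eq (congrArg _ (ran_lam (F := coll k u)))) ?_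
  rw [mem_img]
  simp only [(setLike_ultMem k u).mem_ext]

/-- The function that agrees with `g` where `g i ∈ f i`, and is `∅` elsewhere. -/
noncomputable def trunc (k g f : V) : V := lam k fun i => the fun y => y = app g i ∧ y ε app f i

theorem isFun_trunc (g f : V) : IsFun (trunc k g f) k := isFun_lam

theorem app_trunc_of_mem {g f i : V} (hi : i ε k) (h : app g i ε app f i) :
    app (trunc k g f) i = app g i := by
  rw [trunc, app_lam hi]
  exact the_eq ⟨rfl, h⟩ fun z hz => hz.1

/-- The default value of `the` is `emp`, exactly the exceptional value that `UltMem` allows. -/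
theorem app_trunc_of_not_mem {g f i : V} (hi : i ε k) (h : ¬ app g i ε app f i) :
    app (trunc k g f) i = emp := by
  rw [trunc, app_lam hi, the, dif_neg]
  rintro ⟨y, ⟨rfl, hy⟩, -⟩
  exact h hy

theorem big_trunc_eq (hm : IsMeasure k u) {g f : V} (h : Big k u fun i => app g i ε app f i) :
    Big k u fun i => app g i = app (trunc k g f) i :=
  h.mono hm fun _ hi hi' => (app_trunc_of_mem hi hi').symm

theorem ultMem_trunc (hm : IsMeasure k u) {g f : V} (hf : IsFun f k)
    (h : Big k u fun i => app g i ε app f i) : UltMem k u (trunc k g f) f := by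
  refine ⟨⟨isFun_trunc g f, hf⟩, h.mono hm fun i hi hi' => ?_, fun i hi => ?_⟩
  · rwa [app_trunc_of_mem hi hi']
  · by_cases h' : app g i ε app f i
    · rw [app_trunc_of_mem hi h']; exact Or.inl h'
    · rw [app_trunc_of_not_mem hi h']; exact Or.inr rfl

/-- By induction on `f`: a predecessor `e` of either function lies almost everywhere below the
other, so its truncation there is a predecessor equal to `e` almost everywhere. -/
theorem coll_eq_of_big (hm : IsMeasure k u) {f g : V} (hf : IsFun f k) (hg : IsFun g k)
    (h : Big k u fun i => app f i = app g i) : coll k u f = coll k u g := by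
  revert g
  refine hasInduction_ultMem hm (fun f => IsFun f k → ∀ {g}, IsFun g k →
    Big k u (fun i => app f i = app g i) → coll k u f = coll k u g) inferInstance ?_ f hf
  intro f ih hf g hg hfg
  refine set_ext fun z => ?_
  rw [mem_coll hm, mem_coll hm]
  constructor
  · rintro ⟨e, he, rfl⟩
    have h1 : Big k u fun i => app e i ε app g i := he.2.1.mono₂ hm hfg fun i _ h1 h2 => h2 ▸ h1
    exact ⟨_, ultMem_trunc hm hg h1, ih e he he.1.1 (isFun_trunc e g) (big_trunc_eq hm h1)⟩
  · rintro ⟨e, he, rfl⟩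
    have h1 : Big k u fun i => app e i ε app f i :=
      he.2.1.mono₂ hm hfg fun i _ h1 h2 => by rw [h2]; exact h1
    have h2 := ultMem_trunc hm hf h1
    exact ⟨_, h2, (ih _ h2 (isFun_trunc e f) he.1.1
      ((big_trunc_eq hm h1).mono hm fun _ _ h => h.symm)).symm⟩

theorem coll_mem_of_big (hm : IsMeasure k u) {f g : V} (hf : IsFun f k) (hg : IsFun g k)
    (h : Big k u fun i => app g i ε app f i) : coll k u g ε coll k u f :=
  (mem_coll hm).2 ⟨_, ultMem_trunc hm hf h, coll_eq_of_big hm hg (isFun_trunc g f)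
    (big_trunc_eq hm h)⟩

/-- By induction on `f`. If `f` and `g` differ almost everywhere, some `e` picks values in the
symmetric differences, hence is almost everywhere below exactly one of them. Equality of the
collapses gives a predecessor of the other with the same collapse as `e`, and the induction
hypothesis identifies the two almost everywhere. -/
theorem big_of_coll_eq (hm : IsMeasure k u) {f g : V} (hf : IsFun f k) (hg : IsFun g k)
    (h : coll k u f = coll k u g) : Big k u fun i => app f i = app g i := by
  revert g
  refine hasInduction_ultMem hm (fun f => IsFun f k → ∀ {g}, IsFun g k →
    coll k u f = coll k u g → Big k u (fun i => app f i = app g i)) inferInstance ?_ f hf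
  intro f ih hf g hg hfg
  by_contra hn
  rw [← big_not hm] at hn
  -- By extensionality, sets that differ are distinguished by some element.
  obtain ⟨e, he, he'⟩ := exists_choice_function hm.exists_lim k
    (fun i y => app f i ≠ app g i → ¬ (y ε app f i ↔ y ε app g i)) (fun i _ => by
      by_contra! hc
      exact (hc emp).1 (set_ext fun y => (hc y).2))
  have hn' : Big k u fun i => ¬ (app e i ε app f i ↔ app e i ε app g i) := hn.mono hm he'
  by_cases h1 : Big k u fun i => app e i ε app f i
  · obtain ⟨d, hd, hd'⟩ := (mem_coll hm).1 (hfg ▸ (mem_coll hm).2 ⟨_, ultMem_trunc hm hf h1, rfl⟩)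
    have h2 := (ih _ (ultMem_trunc hm hf h1) (isFun_trunc e f) hd.1.1 hd')
    have h3 : Big k u fun i => app e i ε app g i :=
      (h2.mono₂ hm hd.2.1 (Q := fun i => app (trunc k e f) i ε app g i)
        fun i _ h3 h4 => by rwa [h3]).mono₂ hm (big_trunc_eq hm h1) fun i _ h3 h4 => by rwa [h4]
    obtain ⟨i, -, ⟨h4, h5⟩, h6⟩ := ((h1.and hm h3).and hm hn').exists hm
    exact h6 (iff_of_true h4 h5)
  · have h2 : Big k u fun i => app e i ε app g i :=
      ((big_not hm).2 h1).mono₂ hm hn' fun i _ h2 h3 => by tauto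
    obtain ⟨d, hd, hd'⟩ := (mem_coll hm).1 (hfg ▸ (mem_coll hm).2 ⟨_, ultMem_trunc hm hg h2, rfl⟩)
    have h3 := ih d hd hd.1.1 (isFun_trunc e g) hd'.symm
    refine h1 ((hd.2.1.mono₂ hm h3 (Q := fun i => app (trunc k e g) i ε app f i)
        fun i _ h3 h4 => by rwa [← h4]).mono₂ hm (big_trunc_eq hm h2) fun i _ h3 h4 => by rwa [h4])

theorem coll_eq_iff (hm : IsMeasure k u) {f g : V} (hf : IsFun f k) (hg : IsFun g k) :
    coll k u f = coll k u g ↔ Big k u fun i => app f i = app g i :=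
  ⟨big_of_coll_eq hm hf hg, coll_eq_of_big hm hf hg⟩

theorem coll_mem_iff (hm : IsMeasure k u) {f g : V} (hf : IsFun f k) (hg : IsFun g k) :
    coll k u g ε coll k u f ↔ Big k u fun i => app g i ε app f i := by
  refine ⟨fun h => ?_, coll_mem_of_big hm hf hg⟩
  obtain ⟨e, he, he'⟩ := (mem_coll hm).1 h
  exact (big_of_coll_eq hm hg he.1.1 he').mono₂ hm he.2.1 fun i _ h1 h2 => by rwa [h1]

end Ultrapower

/-! ### Łoś's theorem and the canonical embedding -/

section Los

variable {V : Type u} [LSet.Structure V]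

theorem def_realize {A : Set V} {n m : ℕ} (φ : LSet.BoundedFormula Empty n)
    {F : Fin n → (Fin m → V) → V} (hF : ∀ i, DefF A (F i)) :
    Def A (fun v => φ.Realize default (fun i => F i v)) := by
  have h : Def A (fun v : Fin n → V => φ.Realize default v) :=
    (Def.of_formula φ.toFormula (Sum.map Empty.elim id)).congr fun v => by
      rw [BoundedFormula.realize_toFormula]
      exact iff_of_eq (congrArg₂ _ (Subsingleton.elim _ _) rfl)
  exact Def.comp hF

theorem relMap_mem_iff {Y α : Type*} [LSet.Structure Y] (ts : Fin 2 → LSet.Term α) (v : α → Y) :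
    Structure.RelMap (L := LSet) SetRel.mem (fun i => (ts i).realize v) ↔
      (ts 0).realize v ε (ts 1).realize v := by
  refine iff_of_eq (congrArg _ ?_)
  funext i; fin_cases i <;> rfl

theorem realize_snoc_comm {α β : Type*} {n : ℕ} (f : Fin n → α) (g : α) (F : α → β) :
    (fun j => F ((Fin.snoc f g : Fin (n + 1) → α) j)) = Fin.snoc (fun j => F (f j)) (F g) := by
  funext j
  refine Fin.lastCases ?_ (fun j => ?_) j <;> simp

variable [ZFCModel V] {k u : V}

/-- Łoś's theorem for the ultrapower formed from functions inside the model. -/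
theorem los (hm : IsMeasure k u) {X : Type*} [LSet.Structure X] (π : {f : V // IsFun f k} → X)
    (hsurj : Function.Surjective π)
    (heq : ∀ f g, π f = π g ↔ Big k u fun i => app f.1 i = app g.1 i)
    (hmem : ∀ f g, π f ε π g ↔ Big k u fun i => app f.1 i ε app g.1 i)
    {n : ℕ} (φ : LSet.BoundedFormula Empty n) (f : Fin n → {f : V // IsFun f k}) :
    φ.Realize default (fun j => π (f j)) ↔
      Big k u fun i => φ.Realize default fun j => app (f j).1 i := by
  have hd {n : ℕ} (φ : LSet.BoundedFormula Empty n) (f : Fin n → {f : V // IsFun f k}) :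
      Def Set.univ (fun v : Fin 1 → V => φ.Realize default fun j => app (f j).1 (v 0)) :=
    def_realize φ fun j => inferInstance
  have hterm {n : ℕ} (f : Fin n → {f : V // IsFun f k}) (t : LSet.Term (Empty ⊕ Fin n)) :
      ∃ g, t.realize (Sum.elim default fun j => π (f j)) = π g ∧
        ∀ i, t.realize (Sum.elim default fun j => app (f j).1 i) = app g.1 i := by
    rcases t with (a | j) | F
    · exact a.elim
    · exact ⟨f j, rfl, fun _ => rfl⟩
    · cases F
  induction φ with
  | falsum =>
    refine iff_of_false id fun h => ?_
    obtain ⟨i, -, hi⟩ := h.exists hm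
    exact hi
  | equal s t =>
    obtain ⟨a, ha, ha'⟩ := hterm f s
    obtain ⟨b, hb, hb'⟩ := hterm f t
    simp only [BoundedFormula.Realize, ha, hb, ha', hb', heq]
  | rel R ts =>
    cases R
    obtain ⟨a, ha, ha'⟩ := hterm f (ts 0)
    obtain ⟨b, hb, hb'⟩ := hterm f (ts 1)
    refine (relMap_mem_iff _ _).trans ?_
    rw [ha, hb, hmem]
    refine iff_of_eq (congrArg _ ?_)
    funext i
    have h := relMap_mem_iff ts (Sum.elim default fun j => app (f j).1 i)
    rw [ha', hb'] at h
    exact propext (h.symm.trans BoundedFormula.realize_rel.symm)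
  | imp φ ψ h1 h2 =>
    simp only [BoundedFormula.realize_imp, h1, h2]
    have d1 := hd φ f
    have d2 := hd ψ f
    constructor
    · intro h
      by_cases h' : Big k u fun i => φ.Realize default fun j => app (f j).1 i
      · exact (h h').mono hm fun i _ hi _ => hi
      · exact ((big_not hm).2 h').mono hm fun i _ hi hi' => (hi hi').elim
    · intro h h'
      exact h.mono₂ hm h' fun i _ hi hi' => hi hi'
  | @all n φ ih =>
    have d1 := hd φ.all f
    simp only [BoundedFormula.realize_all] at d1 ⊢
    constructor
    · intro h
      by_contra hc
      rw [← big_not hm] at hc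
      have d2 : Def Set.univ (fun v : Fin 2 → V =>
          φ.Realize default (Fin.snoc (fun j => app (f j).1 (v 0)) (v 1))) := by
        have := def_realize (A := Set.univ) φ (m := 2)
          (F := Fin.snoc (fun j v => app (f j).1 (v 0)) fun v => v 1) (fun i => by
            refine Fin.lastCases ?_ (fun i => ?_) i
            · simp only [Fin.snoc_last]; infer_instance
            · simp only [Fin.snoc_castSucc]; infer_instance)
        refine this.congr fun v => iff_of_eq (congrArg _ ?_)
        exact realize_snoc_comm (fun j v => app (f j).1 (v 0)) (fun v => v 1)
          (fun F : (Fin 2 → V) → V => F v)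
      have d3 : Def Set.univ (fun v : Fin 1 → V =>
          ∀ x, φ.Realize default (Fin.snoc (fun j => app (f j).1 (v 0)) x)) := d1
      have d4 : Def Set.univ (fun v : Fin 2 → V =>
          ∀ x, φ.Realize default (Fin.snoc (fun j => app (f j).1 (v 0)) x)) :=
        d1.rename (m := 2) (fun _ => 0)
      -- A function choosing a counterexample at each index that has one; its class refutes the
      -- universal statement in the ultrapower.
      obtain ⟨g, hg, hg'⟩ := exists_choice_function hm.exists_lim k
        (fun i y => (¬ ∀ x, φ.Realize default (Fin.snoc (fun j => app (f j).1 i) x)) →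
          ¬ φ.Realize default (Fin.snoc (fun j => app (f j).1 i) y)) (fun i _ => by
          by_cases h : ∀ x, φ.Realize default (Fin.snoc (fun j => app (f j).1 i) x)
          · exact ⟨emp, fun h' => (h' h).elim⟩
          · obtain ⟨x, hx⟩ := not_forall.1 h
            exact ⟨x, fun _ => hx⟩)
      have h1 := (ih (Fin.snoc f ⟨g, hg⟩)).1 (by
        rw [realize_snoc_comm f ⟨g, hg⟩ π]; exact h _)
      obtain ⟨i, hi, h2, h3⟩ := (hc.and hm h1).exists hm
      rw [realize_snoc_comm f ⟨g, hg⟩ (fun g => app g.1 i)] at h3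
      exact hg' i hi h2 h3
    · intro h x
      obtain ⟨g, rfl⟩ := hsurj x
      rw [← realize_snoc_comm f g π]
      refine (ih _).2 ?_
      have d2 := hd φ (Fin.snoc f g)
      refine h.mono hm fun i _ hi => ?_
      rw [realize_snoc_comm f g (fun g => app g.1 i)]
      exact hi _

theorem ord_coll (hm : IsMeasure k u) {f : V} (h : Big k u fun i => Ord (app f i)) :
    Ord (coll k u f) := by
  constructor
  · intro y hy z hz
    obtain ⟨g, hg, rfl⟩ := (mem_coll hm).1 hy
    obtain ⟨e, he, rfl⟩ := (mem_coll hm).1 hz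
    refine coll_mem_of_big hm hg.1.2 he.1.1 ?_
    exact (h.and hm hg.2.1).mono₂ hm he.2.1 fun i _ h1 h2 => h1.1.mem_trans h2 h1.2
  · intro y hy z hz t ht
    obtain ⟨g, hg, rfl⟩ := (mem_coll hm).1 hy
    obtain ⟨e, he, rfl⟩ := (mem_coll hm).1 hz
    obtain ⟨d, hd, rfl⟩ := (mem_coll hm).1 ht
    refine coll_mem_of_big hm hg.1.1 hd.1.1 ?_
    exact ((h.and hm hg.2.1).and hm he.2.1).mono₂ hm hd.2.1 fun i _ h1 h2 =>
      (h1.1.1.of_mem h1.1.2).mem_trans h2 h1.2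

/-- The canonical embedding into the collapsed ultrapower. -/
noncomputable def emb (k u a : V) : V := coll k u (lam k fun _ => a)

theorem emb_mem (hm : IsMeasure k u) {a b : V} (h : a ε b) : emb k u a ε emb k u b :=
  coll_mem_of_big hm isFun_lam isFun_lam
    (Big.of_forall hm fun i hi => by rwa [app_lam hi, app_lam hi])

theorem ord_emb (hm : IsMeasure k u) {a : V} (ha : Ord a) : Ord (emb k u a) :=
  ord_coll hm (Big.of_forall hm fun i hi => by rwa [app_lam hi])

/-- If `j(a) ∈ a` held, then `j(j(a)) ∈ j(a)`, so no ordinal can be the least with this property. -/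
theorem sub_emb (hm : IsMeasure k u) {a : V} (ha : Ord a) : Sub a (emb k u a) := by
  refine ha.sub_of_not_mem (ord_emb hm ha) ?_
  have : DefF Set.univ (fun v : Fin 1 → V => emb k u (v 0)) := by unfold emb; infer_instance
  refine Ord.induction (P := fun a => ¬ emb k u a ε a) (fun a ha ih h => ?_) ha
  exact ih _ h (emb_mem hm h)

/-- Since `a ≤ j(a)` and every element of a collapse value is again a collapse value, `a` is
reached. -/
theorem exists_coll_eq_of_ord (hm : IsMeasure k u) {a : V} (ha : Ord a) :
    ∃ f, IsFun f k ∧ coll k u f = a := by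
  rcases ha.mem_or_eq_of_sub (ord_emb hm ha) (sub_emb hm ha) with h | h
  · obtain ⟨g, hg, h⟩ := (mem_coll hm).1 h
    exact ⟨g, hg.1.1, h.symm⟩
  · exact ⟨_, isFun_lam, h.symm⟩

theorem emb_ne (hm : IsMeasure k u) : emb k u k ≠ k := by
  intro h
  have hk := hm.spec.ord
  -- The class of the identity. It lies in `j(k)`, and it is above each `a ∈ k` because by
  -- completeness almost all `i` are greater than `a`. If `j(k) = k`, this gives `d ∈ k ⊆ d`.
  let d : V := coll k u (lam k fun i => i)
  have hd : d ε emb k u k := coll_mem_of_big hm isFun_lam isFun_lam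
    (Big.of_forall hm fun i hi => by rwa [app_lam hi, app_lam hi])
  have hdo : Ord d := ord_coll hm (Big.of_forall hm fun i hi => by
    rw [app_lam hi]; exact hk.of_mem hi)
  have hsub : Sub k d := by
    intro a ha
    have hao := hk.of_mem ha
    have h1 : Big k u fun i => ∀ b, b ε a → i ≠ b :=
      Big.all (P := fun b i => i ≠ b) hm ha fun b _ => big_ne hm b
    have h2 : emb k u a ε d := by
      refine coll_mem_of_big hm isFun_lam isFun_lam (h1.mono₂ hm (big_ne hm a) ?_)
      intro i hi hi' hia
      rw [app_lam hi, app_lam hi]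
      rcases hao.trichotomy (hk.of_mem hi) with h | h | h
      · exact h
      · exact (hia h.symm).elim
      · exact (hi' i h rfl).elim
    rcases hao.mem_or_eq_of_sub (ord_emb hm hao) (sub_emb hm hao) with h3 | h3
    · exact hdo.mem_trans h3 h2
    · rwa [h3]
  rw [h] at hd
  exact not_mem_self d (hsub d hd)

/-- The collapsed ultrapower is a proper subclass. -/
theorem exists_forall_coll_ne (hm : IsMeasure k u) :
    ∃ x, ∀ f, IsFun f k → coll k u f ≠ x := by
  by_contra! hc
  -- The measure is quantified away so that the least `k` with this property is definable without
  -- parameters.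
  let Q : V → Prop := fun k => ∃ u, IsMeasure k u ∧ ∀ x, ∃ f, IsFun f k ∧ coll k u f = x
  have hQ {A : Set V} {n} {F : (Fin n → V) → V} [DefF A F] : Def A (fun v => Q (F v)) :=
    have : Def A (fun v : Fin 1 → V => Q (v 0)) := by unfold Q; infer_instance
    Def.comp₁ Q
  obtain ⟨k, hko, ⟨⟨u, hm, hc⟩, hk⟩⟩ := Ord.exists_least (P := Q) hm.spec.ord ⟨u, hm, hc⟩
  obtain ⟨ψ, hψ⟩ := Def.exists_formula_empty
    (inferInstance : Def (∅ : Set V) (fun v : Fin 1 → V => Q (v 0) ∧ ∀ y, y ε v 0 → ¬ Q y))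
  -- By `hc` the collapse is onto the universe, so Łoś's theorem here compares the universe with
  -- itself: `j(k)` is also least with `Q`.
  have hlos := los hm (fun f => coll k u f.1) (fun x => let ⟨f, hf, h⟩ := hc x; ⟨⟨f, hf⟩, h⟩)
    (fun f g => coll_eq_iff hm f.2 g.2) (fun f g => coll_mem_iff hm g.2 f.2) ψ
    (fun _ => ⟨lam k fun _ => k, isFun_lam⟩)
  have h1 := hlos.2 (Big.of_forall hm fun i hi => by
    rw [hψ, app_lam hi]; exact ⟨⟨u, hm, hc⟩, hk⟩)
  rw [hψ] at h1
  rcases hko.trichotomy (ord_emb hm hko) with h | h | h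
  · exact h1.2 k h ⟨u, hm, hc⟩
  · exact emb_ne hm h.symm
  · exact hk _ h h1.1

end Los

/-! ### Transitive class models -/

section ClassModel

variable {V : Type u} [LSet.Structure V] {M : LSet.Substructure V}

theorem coe_mem_coe {x y : M} : (x : V) ε y ↔ x ε y := by
  refine iff_of_eq (congrArg (Structure.RelMap (L := LSet) (M := V) SetRel.mem) ?_)
  funext i; fin_cases i <;> rfl

/-- A class definable in `M` is definable in `V`, if `M` is. -/
theorem Def.transfer {r : V → M} (hr : ∀ x : M, r x = x) {B : Set V}
    (hdr : DefF B (fun v : Fin 1 → V => (r (v 0) : V))) {A : Set M}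
    (hA : ∀ a ∈ A, ∀ m, DefF B (fun _ : Fin m → V => (a : V))) {n : ℕ} {P : (Fin n → M) → Prop}
    (hP : Def A P) : Def B (fun v => P (fun i => r (v i))) := by
  obtain ⟨φ, hφ⟩ := hP
  refine Def.congr ?_ fun v => hφ _
  have ht (k : ℕ) (t : LSet.Term (A ⊕ Fin k)) :
      DefF B (fun v : Fin k → V => ((t.realize (Sum.elim Subtype.val fun i => r (v i)) : M) : V)) := by
    rcases t with (a | i) | f
    · exact hA _ a.2 k
    · exact hdr.rename fun _ => i
    · cases f
  clear hφ P
  induction φ with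
  | falsum => exact Def.const False
  | equal s t =>
    have h1 := ht _ s
    have h2 := ht _ t
    exact (inferInstance : Def B fun v => ((s.realize (Sum.elim Subtype.val fun i => r (v i)) : M) : V) =
      (t.realize (Sum.elim Subtype.val fun i => r (v i)) : M)).congr fun v => Subtype.coe_inj
  | rel R ts =>
    cases R
    have h1 := ht _ (ts 0)
    have h2 := ht _ (ts 1)
    exact (inferInstance : Def B fun v =>
      (((ts 0).realize (Sum.elim Subtype.val fun i => r (v i)) : M) : V) ε
        ((ts 1).realize (Sum.elim Subtype.val fun i => r (v i)) : M)).congr fun v =>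
      coe_mem_coe.trans ((relMap_mem_iff ts _).symm.trans BoundedFormula.realize_rel.symm)
  | imp φ ψ h1 h2 => exact Def.imp (hP := h1) (hQ := h2)
  | @all k φ h =>
    -- As `r` maps onto `M`, a quantifier over `M` is a quantifier over `V` composed with `r`.
    have h' : Def B (fun v => ∀ x : V, φ.Realize Subtype.val
        (fun i => r ((Fin.snoc v x : Fin (k + 1) → V) i))) :=
      Def.all (hP := h.congr fun v => iff_of_eq (congrArg (φ.Realize Subtype.val) (by
        rw [show (Fin.snoc (fun i => v i.castSucc) (v (Fin.last _)) : Fin (k + 1) → V) = v from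
          Fin.snoc_init_self v])))
    refine h'.congr fun v => ?_
    simp only [realize_snoc_comm, BoundedFormula.realize_all]
    exact ⟨fun h x => hr x ▸ h x, fun h x => h _⟩

theorem realize_relativize {ψ : LSet.Formula (Fin 2)} {p : V}
    (hψ : ∀ x : V, x ∈ M ↔ ψ.Realize ![x, p]) {n : ℕ} (φ : Fm Empty n) (xs : Fin n → M) :
    (relativize ψ φ).Realize ![p] (fun i => (xs i : V)) ↔ φ.Realize default xs := by
  have ht {n : ℕ} (t : LSet.Term (Empty ⊕ Fin n)) (xs : Fin n → M) :
      (t.relabel (Sum.map Empty.elim id) : LSet.Term (Fin 1 ⊕ Fin n)).realize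
        (Sum.elim ![p] fun i => (xs i : V)) = t.realize (Sum.elim default xs) := by
    rcases t with (a | j) | F
    · exact a.elim
    · rfl
    · cases F
  induction φ with
  | falsum => rfl
  | equal s t =>
    simp only [relativize, BoundedFormula.Realize, ht, Subtype.coe_inj]
  | rel R ts =>
    cases R
    refine (relMap_mem_iff (fun i => (ts i).relabel (Sum.map Empty.elim id)) _).trans ?_
    rw [ht, ht, coe_mem_coe]
    exact (relMap_mem_iff ts _).symm.trans BoundedFormula.realize_rel.symm
  | imp φ χ h1 h2 =>
    simp only [relativize, BoundedFormula.realize_imp, h1, h2]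
  | @all n φ h =>
    simp only [relativize, BoundedFormula.realize_all, BoundedFormula.realize_imp]
    have key : ∀ x, ((inClass ψ new).Realize ![p] (Fin.snoc (fun i => (xs i : V)) x : Fin (n + 1) → V)
        ↔ x ∈ M) := by
      intro x
      rw [inClass, realize_inst, hψ]
      refine iff_of_eq (congrArg _ ?_)
      funext i; fin_cases i <;> simp
    constructor
    · intro h' x
      refine (h _).1 ?_
      rw [realize_snoc_comm xs x (fun x : M => (x : V))]
      exact h' x ((key x).2 x.2)
    · intro h' x hx
      have := (h _).2 (h' ⟨x, (key x).1 hx⟩)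
      rwa [realize_snoc_comm xs _ (fun x : M => (x : V))] at this

theorem IsTransitiveClassModel.zfcModel (hM : IsTransitiveClassModel M) : ZFCModel M := ⟨hM.models⟩

theorem IsTransitiveClassModel.mem_of_mem (hM : IsTransitiveClassModel M) {x z : V} (hx : x ∈ M)
    (hz : z ε x) : z ∈ M := hM.transitive x hx z hz

/-- Bounded quantifiers mean the same in `M` and in `V` by transitivity; the absoluteness of
inclusion, ordinals and limits follows. -/
theorem IsTransitiveClassModel.forall_mem_coe (hM : IsTransitiveClassModel M) {x : M}
    {Q : V → Prop} : (∀ z, z ε (x : V) → Q z) ↔ ∀ z : M, z ε x → Q z :=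
  ⟨fun h z hz => h z (coe_mem_coe.2 hz), fun h z hz =>
    h ⟨z, hM.mem_of_mem x.2 hz⟩ (coe_mem_coe.1 hz)⟩

theorem IsTransitiveClassModel.sub_coe (hM : IsTransitiveClassModel M) {x y : M} :
    Sub (x : V) y ↔ Sub x y := by
  simp only [Sub, hM.forall_mem_coe, coe_mem_coe]

theorem IsTransitiveClassModel.ord_coe (hM : IsTransitiveClassModel M) {x : M} :
    Ord (x : V) ↔ Ord x := by
  simp only [Ord, hM.forall_mem_coe, hM.sub_coe]

theorem IsTransitiveClassModel.isLim_coe (hM : IsTransitiveClassModel M) {x : M} :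
    IsLim (x : V) ↔ IsLim x := by
  simp only [IsLim, hM.forall_mem_coe, hM.ord_coe]
  refine and_congr (and_congr Iff.rfl ⟨?_, ?_⟩) (forall₂_congr fun y _ => ⟨?_, ?_⟩)
  · rintro ⟨y, hy⟩; exact ⟨⟨y, hM.mem_of_mem x.2 hy⟩, coe_mem_coe.1 hy⟩
  · rintro ⟨y, hy⟩; exact ⟨y, coe_mem_coe.2 hy⟩
  · rintro ⟨z, hz, h⟩; exact ⟨⟨z, hM.mem_of_mem x.2 hz⟩, coe_mem_coe.1 hz, coe_mem_coe.1 h⟩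
  · rintro ⟨z, hz, h⟩; exact ⟨z, coe_mem_coe.2 hz, coe_mem_coe.2 h⟩

theorem IsTransitiveClassModel.mem_of_ord (hM : IsTransitiveClassModel M) {x : V} (hx : Ord x) :
    x ∈ M := hM.ordinals x (by simpa [Formula.Realize] using hx)

theorem IsTransitiveClassModel.def_mem (hM : IsTransitiveClassModel M) :
    ∃ p : V, ∀ B : Set V, p ∈ B → Def B (fun v : Fin 1 → V => v 0 ∈ M) := by
  obtain ⟨ψ, p, hψ⟩ := hM.definable
  refine ⟨p, fun B hp => ?_⟩
  exact (Def.of_formula ψ ![Sum.inr 0, Sum.inl ⟨p, hp⟩]).congr fun v => by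
    rw [hψ]
    refine iff_of_eq (congrArg _ ?_)
    funext i; fin_cases i <;> rfl

variable [ZFCModel V]

theorem ord_emp : Ord (emp : V) := ⟨fun y hy => (not_mem_emp y hy).elim,
  fun y hy => (not_mem_emp y hy).elim⟩

open Classical in
/-- A retraction of the universe to a class model. -/
noncomputable def IsTransitiveClassModel.retract (hM : IsTransitiveClassModel M) (x : V) : M :=
  if h : x ∈ M then ⟨x, h⟩ else ⟨emp, hM.mem_of_ord ord_emp⟩

theorem IsTransitiveClassModel.retract_coe (hM : IsTransitiveClassModel M) (x : M) :
    hM.retract x = x := by simp [retract]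

theorem IsTransitiveClassModel.defF_retract (hM : IsTransitiveClassModel M) {B : Set V}
    (hB : Def B (fun v : Fin 1 → V => v 0 ∈ M)) :
    DefF B (fun v : Fin 1 → V => (hM.retract (v 0) : V)) := by
  have hB' {n} {F : (Fin n → V) → V} [DefF B F] : Def B (fun v => F v ∈ M) :=
    Def.comp₁ (fun x => x ∈ M)
  refine DefF.of_graph (R := fun v y => (v 0 ∈ M ∧ y = v 0) ∨ (¬ v 0 ∈ M ∧ y = emp)) fun v y => ?_
  by_cases h : v 0 ∈ M <;> simp [retract, h]

theorem IsTransitiveClassModel.coe_upair (hM : IsTransitiveClassModel M) [ZFCModel M] (x y : M) :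
    ((upair x y : M) : V) = upair (x : V) y := by
  refine set_ext fun z => ⟨fun hz => ?_, fun hz => ?_⟩
  · have h : (⟨z, hM.mem_of_mem (upair x y).2 hz⟩ : M) ε upair x y := coe_mem_coe.1 hz
    rcases mem_upair.1 h with h | h
    · exact mem_upair.2 (Or.inl (congrArg Subtype.val h))
    · exact mem_upair.2 (Or.inr (congrArg Subtype.val h))
  · rcases mem_upair.1 hz with rfl | rfl
    · exact coe_mem_coe.2 (mem_upair.2 (Or.inl rfl))
    · exact coe_mem_coe.2 (mem_upair.2 (Or.inr rfl))

theorem IsTransitiveClassModel.coe_opair (hM : IsTransitiveClassModel M) [ZFCModel M] (x y : M) :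
    ((opair x y : M) : V) = opair (x : V) y := by
  simp only [opair, sing, hM.coe_upair]

theorem IsTransitiveClassModel.opair_mem (hM : IsTransitiveClassModel M) {x y : V} :
    opair x y ∈ M ↔ x ∈ M ∧ y ∈ M := by
  have := hM.zfcModel
  constructor
  · intro h
    have h1 : upair x y ∈ M := hM.mem_of_mem h (mem_upair.2 (Or.inr rfl))
    exact ⟨hM.mem_of_mem h1 (mem_upair.2 (Or.inl rfl)),
      hM.mem_of_mem h1 (mem_upair.2 (Or.inr rfl))⟩
  · rintro ⟨hx, hy⟩
    have := (opair (⟨x, hx⟩ : M) ⟨y, hy⟩).2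
    rwa [hM.coe_opair] at this

/-- Every subset of a transitive class model is covered by an element of it. -/
theorem IsTransitiveClassModel.exists_cover (hM : IsTransitiveClassModel M)
    (hlim : ∃ w : M, IsLim w) {x : V} (hx : ∀ z, z ε x → z ∈ M) : ∃ y, y ∈ M ∧ Sub x y := by
  have := hM.zfcModel
  obtain ⟨p, hp⟩ := hM.def_mem
  have hd := hp Set.univ trivial
  have hd' {n} {F : (Fin n → V) → V} [DefF Set.univ F] : Def Set.univ (fun v => F v ∈ M) :=
    Def.comp₁ (fun x => x ∈ M)
  -- Ranks are computed in `M`, but their supremum over `x` is taken in `V`, where `x` is a set.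
  -- This supremum is an ordinal, hence in `M`, and a level of the hierarchy of `M` covers `x`.
  let F : V → V := fun z => (rank (hM.retract z) : M)
  have hF : DefF Set.univ (fun v : Fin 1 → V => F (v 0)) := by
    have h1 : Def Set.univ (fun w : Fin 2 → V =>
        hM.retract (w 1) = rank (hM.retract (w 0))) :=
      Def.transfer (P := fun w : Fin 2 → M => w 1 = rank (w 0)) hM.retract_coe
        (hM.defF_retract hd) (A := Set.univ) (fun a _ m => inferInstance) inferInstance
    have h2 {n} {F F' : (Fin n → V) → V} [DefF Set.univ F] [DefF Set.univ F'] :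
        Def Set.univ (fun v => hM.retract (F v) = rank (hM.retract (F' v))) :=
      Def.comp₂ (fun y x => hM.retract y = rank (hM.retract x)) (hR := h1.rename ![1, 0])
    refine DefF.of_graph (R := fun v y => y ∈ M ∧ hM.retract y = rank (hM.retract (v 0)))
      fun v y => ⟨?_, ?_⟩
    · rintro rfl
      exact ⟨Subtype.coe_prop _, hM.retract_coe _⟩
    · rintro ⟨h1, h2⟩
      rw [show hM.retract y = ⟨y, h1⟩ from hM.retract_coe ⟨y, h1⟩] at h2
      exact congrArg Subtype.val h2
  have ho : Ord (sUnion (img x F)) := Ord.sUnion fun b hb => by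
    obtain ⟨z, -, rfl⟩ := mem_img.1 hb
    exact hM.ord_coe.2 (ord_rank hlim _)
  let β : M := ⟨_, hM.mem_of_ord ho⟩
  have hβ : Ord β := hM.ord_coe.1 ho
  obtain ⟨s, hs⟩ := exists_level hlim hβ.succ
  refine ⟨s, s.2, fun z hz => ?_⟩
  have h1 : (⟨z, hx z hz⟩ : M) ε s := by
    rw [hs, mem_succ]
    refine (ord_rank hlim _).mem_or_eq_of_sub hβ (hM.sub_coe.1 fun t ht => ?_)
    refine mem_sUnion.2 ⟨_, mem_img.2 ⟨z, hz, rfl⟩, ?_⟩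
    show t ε ((rank (hM.retract z) : M) : V)
    rwa [show hM.retract z = ⟨z, hx z hz⟩ from hM.retract_coe ⟨z, hx z hz⟩]
  exact coe_mem_coe.2 h1

end ClassModel

/-! ### Class models satisfy the formula TM -/

section Closure

variable {V : Type u} [LSet.Structure V] {M : LSet.Substructure V}

/-- The absoluteness pattern behind the Gödel operations: a set formed in `M` is also correct in `V`
if its defining condition is absolute and forces membership in `M`. -/
theorem IsTransitiveClassModel.exists_set (hM : IsTransitiveClassModel M) {Q : V → Prop}
    (c : M) {Q' : M → Prop} (hc : ∀ w : M, w ε c ↔ Q' w) (hQ : ∀ w, Q w → w ∈ M)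
    (hQQ' : ∀ w : M, Q w ↔ Q' w) : ∃ c : V, c ∈ M ∧ ∀ w, w ε c ↔ Q w := by
  refine ⟨c, c.2, fun w => ⟨fun hw => ?_, fun hw => ?_⟩⟩
  · exact (hQQ' ⟨w, hM.mem_of_mem c.2 hw⟩).2 ((hc _).1 (coe_mem_coe.1 hw))
  · exact coe_mem_coe.2 ((hc ⟨w, hQ w hw⟩).2 ((hQQ' ⟨w, hQ w hw⟩).1 hw))

theorem IsTransitiveClassModel.exists_mem_coe (hM : IsTransitiveClassModel M) {x : M}
    {Q : V → Prop} : (∃ z, z ε (x : V) ∧ Q z) ↔ ∃ z : M, z ε x ∧ Q z :=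
  ⟨fun ⟨z, hz, h⟩ => ⟨⟨z, hM.mem_of_mem x.2 hz⟩, coe_mem_coe.1 hz, h⟩,
    fun ⟨z, hz, h⟩ => ⟨z, coe_mem_coe.2 hz, h⟩⟩

theorem realize_inClass {ψ : LSet.Formula (Fin 2)} {p : V}
    (hψ : ∀ x : V, x ∈ M ↔ ψ.Realize ![x, p]) {n : ℕ} (xs : Fin n → V) (x : Var (Fin 1) n) :
    (inClass ψ x).Realize ![p] xs ↔ val ![p] xs x ∈ M := by
  rw [inClass, realize_inst, hψ]
  refine iff_of_eq (congrArg _ ?_)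
  funext i; fin_cases i <;> simp

/-- The image of a set of the class model under a definable partial function. -/
theorem IsTransitiveClassModel.exists_image (hM : IsTransitiveClassModel M) (a : M)
    {R : V → V → Prop} {R' : M → M → Prop} [hR : Def Set.univ (fun v : Fin 2 → M => R' (v 0) (v 1))]
    (hfun : ∀ x y y', R' x y → R' x y' → y = y') (hmem : ∀ x y, x ∈ M → R x y → y ∈ M)
    (hRR' : ∀ x y : M, R x y ↔ R' x y) : ∃ c : V, c ∈ M ∧ ∀ w, w ε c ↔ ∃ x, x ε (a : V) ∧ R x w := by
  have := hM.zfcModel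
  obtain ⟨c, hc⟩ := exists_repl a R' fun x _ => hfun x
  refine hM.exists_set c hc ?_ fun w => ?_
  · rintro w ⟨x, hx, h⟩
    exact hmem x w (hM.mem_of_mem a.2 hx) h
  · rw [hM.exists_mem_coe]
    simp only [hRR']

theorem IsTransitiveClassModel.exists_sep (hM : IsTransitiveClassModel M) (a : M) {P : V → Prop}
    {P' : M → Prop} [Def Set.univ (fun v : Fin 1 → M => P' (v 0))] (hP : ∀ x : M, P x ↔ P' x) :
    ∃ c : V, c ∈ M ∧ ∀ w, w ε c ↔ w ε (a : V) ∧ P w := by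
  have := hM.zfcModel
  refine hM.exists_set (sep a P') (fun w => mem_sep) (fun w hw => hM.mem_of_mem a.2 hw.1)
    fun w => and_congr coe_mem_coe (hP w)

theorem realize_closedUnder {ψ : LSet.Formula (Fin 2)} {p : V}
    (hψ : ∀ x : V, x ∈ M ↔ ψ.Realize ![x, p])
    (Γ : {n : ℕ} → Var (Fin 1) n → Var (Fin 1) n → Var (Fin 1) n → Fm (Fin 1) n)
    (Q : V → V → V → Prop)
    (hΓ : ∀ {n : ℕ} (xs : Fin n → V) (w a b), (Γ w a b).Realize ![p] xs ↔
      Q (val ![p] xs w) (val ![p] xs a) (val ![p] xs b))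
    (h : ∀ a b : M, ∃ c, c ∈ M ∧ ∀ w, w ε c ↔ Q w a b) :
    (closedUnder ψ Γ).Realize ![p] := by
  simp only [closedUnder, Formula.Realize, realize_allF, BoundedFormula.realize_imp,
    BoundedFormula.realize_inf, realize_inClass hψ, val_up, val_new, realize_exF,
    BoundedFormula.realize_iff, realize_memF, hΓ]
  exact fun a b hab => h ⟨a, hab.1⟩ ⟨b, hab.2⟩

variable [ZFCModel V]

theorem IsTransitiveClassModel.opair_iff (hM : IsTransitiveClassModel M) [ZFCModel M] {x y z : M} :
    (z : V) = opair (x : V) y ↔ z = opair x y := by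
  rw [← hM.coe_opair, Subtype.coe_inj]

theorem IsTransitiveClassModel.opair_iff' (hM : IsTransitiveClassModel M) {x y z : V}
    (h : z = opair x y) : z ∈ M ↔ x ∈ M ∧ y ∈ M := by rw [h, hM.opair_mem]

theorem IsTransitiveClassModel.exists_prod (hM : IsTransitiveClassModel M) (a b : M) :
    ∃ c : V, c ∈ M ∧ ∀ w, w ε c ↔ ∃ x, x ε (a : V) ∧ ∃ y, y ε (b : V) ∧ w = opair x y := by
  have := hM.zfcModel
  refine hM.exists_set (prod a b) (fun w => mem_prod) ?_ fun w => ?_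
  · rintro w ⟨x, hx, y, hy, rfl⟩
    exact hM.opair_mem.2 ⟨hM.mem_of_mem a.2 hx, hM.mem_of_mem b.2 hy⟩
  · simp only [hM.exists_mem_coe, hM.opair_iff]

theorem IsTransitiveClassModel.exists_dom (hM : IsTransitiveClassModel M) (a : M) :
    ∃ c : V, c ∈ M ∧ ∀ w, w ε c ↔ ∃ p, p ε (a : V) ∧ ∃ y, p = opair w y := by
  have := hM.zfcModel
  refine hM.exists_image a (R := fun p w => ∃ y, p = opair w y)
    (R' := fun p w => ∃ y, p = opair w y) ?_ ?_ ?_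
  · rintro _ w w' ⟨y, rfl⟩ ⟨y', h⟩
    exact (opair_inj.1 h).1
  · rintro _ w hp ⟨y, rfl⟩
    exact (hM.opair_mem.1 hp).1
  · refine fun p w => ⟨?_, ?_⟩
    · rintro ⟨y, h⟩
      exact ⟨⟨y, ((hM.opair_iff' h).1 p.2).2⟩, hM.opair_iff.1 h⟩
    · rintro ⟨y, h⟩
      exact ⟨y, hM.opair_iff.2 h⟩

theorem IsTransitiveClassModel.exists_converse (hM : IsTransitiveClassModel M) (a : M) :
    ∃ c : V, c ∈ M ∧ ∀ w, w ε c ↔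
      ∃ p, p ε (a : V) ∧ ∃ x y, w = opair x y ∧ p = opair y x := by
  have := hM.zfcModel
  refine hM.exists_image a (R := fun p w => ∃ x y, w = opair x y ∧ p = opair y x)
    (R' := fun p w => ∃ x y, w = opair x y ∧ p = opair y x) ?_ ?_ ?_
  · rintro _ _ _ ⟨x, y, rfl, rfl⟩ ⟨x', y', rfl, h⟩
    obtain ⟨rfl, rfl⟩ := opair_inj.1 h
    rfl
  · rintro _ _ hp ⟨x, y, rfl, rfl⟩
    exact hM.opair_mem.2 (hM.opair_mem.1 hp).symm
  · refine fun p w => ⟨?_, ?_⟩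
    · rintro ⟨x, y, h, h'⟩
      obtain ⟨hx, hy⟩ := (hM.opair_iff' h).1 w.2
      exact ⟨⟨x, hx⟩, ⟨y, hy⟩, hM.opair_iff.1 h, hM.opair_iff.1 h'⟩
    · rintro ⟨x, y, h, h'⟩
      exact ⟨x, y, hM.opair_iff.2 h, hM.opair_iff.2 h'⟩

theorem opair₃_inj {x y z x' y' z' : V} :
    opair (opair x y) z = opair (opair x' y') z' ↔ (x = x' ∧ y = y') ∧ z = z' := by
  rw [opair_inj, opair_inj]

theorem IsTransitiveClassModel.opair₃_mem (hM : IsTransitiveClassModel M) {x y z : V} :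
    opair (opair x y) z ∈ M ↔ (x ∈ M ∧ y ∈ M) ∧ z ∈ M := by
  rw [hM.opair_mem, hM.opair_mem]

theorem IsTransitiveClassModel.opair₃_iff (hM : IsTransitiveClassModel M) [ZFCModel M]
    {x y z w : M} : (w : V) = opair (opair (x : V) y) z ↔ w = opair (opair x y) z := by
  rw [← hM.coe_opair, ← hM.coe_opair, Subtype.coe_inj]

theorem IsTransitiveClassModel.exists_perm₁ (hM : IsTransitiveClassModel M) (a : M) :
    ∃ c : V, c ∈ M ∧ ∀ w, w ε c ↔ ∃ p, p ε (a : V) ∧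
      ∃ x y z, w = opair (opair x y) z ∧ p = opair (opair x z) y := by
  have := hM.zfcModel
  refine hM.exists_image a
    (R := fun p w => ∃ x y z, w = opair (opair x y) z ∧ p = opair (opair x z) y)
    (R' := fun p w => ∃ x y z, w = opair (opair x y) z ∧ p = opair (opair x z) y) ?_ ?_ ?_
  · rintro _ _ _ ⟨x, y, z, rfl, rfl⟩ ⟨x', y', z', rfl, h⟩
    obtain ⟨⟨rfl, rfl⟩, rfl⟩ := opair₃_inj.1 h
    rfl
  · rintro _ _ hp ⟨x, y, z, rfl, rfl⟩
    rw [hM.opair₃_mem] at hp ⊢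
    tauto
  · refine fun p w => ⟨?_, ?_⟩
    · rintro ⟨x, y, z, h, h'⟩
      obtain ⟨⟨hx, hy⟩, hz⟩ := hM.opair₃_mem.1 (h ▸ w.2)
      exact ⟨⟨x, hx⟩, ⟨y, hy⟩, ⟨z, hz⟩, hM.opair₃_iff.1 h, hM.opair₃_iff.1 h'⟩
    · rintro ⟨x, y, z, h, h'⟩
      exact ⟨x, y, z, hM.opair₃_iff.2 h, hM.opair₃_iff.2 h'⟩

theorem IsTransitiveClassModel.exists_perm₂ (hM : IsTransitiveClassModel M) (a : M) :
    ∃ c : V, c ∈ M ∧ ∀ w, w ε c ↔ ∃ p, p ε (a : V) ∧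
      ∃ x y z, w = opair (opair x y) z ∧ p = opair (opair y z) x := by
  have := hM.zfcModel
  refine hM.exists_image a
    (R := fun p w => ∃ x y z, w = opair (opair x y) z ∧ p = opair (opair y z) x)
    (R' := fun p w => ∃ x y z, w = opair (opair x y) z ∧ p = opair (opair y z) x) ?_ ?_ ?_
  · rintro _ _ _ ⟨x, y, z, rfl, rfl⟩ ⟨x', y', z', rfl, h⟩
    obtain ⟨⟨rfl, rfl⟩, rfl⟩ := opair₃_inj.1 h
    rfl
  · rintro _ _ hp ⟨x, y, z, rfl, rfl⟩
    rw [hM.opair₃_mem] at hp ⊢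
    tauto
  · refine fun p w => ⟨?_, ?_⟩
    · rintro ⟨x, y, z, h, h'⟩
      obtain ⟨⟨hx, hy⟩, hz⟩ := hM.opair₃_mem.1 (h ▸ w.2)
      exact ⟨⟨x, hx⟩, ⟨y, hy⟩, ⟨z, hz⟩, hM.opair₃_iff.1 h, hM.opair₃_iff.1 h'⟩
    · rintro ⟨x, y, z, h, h'⟩
      exact ⟨x, y, z, hM.opair₃_iff.2 h, hM.opair₃_iff.2 h'⟩

theorem IsTransitiveClassModel.realize_goedelClosed (hM : IsTransitiveClassModel M)
    {ψ : LSet.Formula (Fin 2)} {p : V} (hψ : ∀ x : V, x ∈ M ↔ ψ.Realize ![x, p]) :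
    (goedelClosed ψ).Realize ![p] := by
  have := hM.zfcModel
  unfold goedelClosed
  simp only [Formula.realize_inf]
  refine ⟨⟨⟨⟨⟨⟨⟨⟨⟨?_, ?_⟩, ?_⟩, ?_⟩, ?_⟩, ?_⟩, ?_⟩, ?_⟩, ?_⟩, ?_⟩
  · refine realize_closedUnder hψ _ (fun w a b => w = a ∨ w = b) (by simp) fun a b => ?_
    exact ⟨_, (upair a b).2, fun w => by rw [hM.coe_upair, mem_upair]⟩
  · refine realize_closedUnder hψ _ (fun w a b => ∃ x, x ε a ∧ ∃ y, y ε b ∧ w = opair x y)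
      (by simp [isOPair_iff]) fun a b => hM.exists_prod a b
  · refine realize_closedUnder hψ _
      (fun w a b => ∃ x, x ε a ∧ ∃ y, y ε b ∧ x ε y ∧ w = opair x y)
      (by simp [isOPair_iff]) fun a b => ?_
    obtain ⟨c, hc, hc'⟩ := hM.exists_prod a b
    have hP (w : M) : (∃ x y : V, x ε y ∧ (w : V) = opair x y) ↔ ∃ x y : M, x ε y ∧ w = opair x y := by
      constructor
      · rintro ⟨x, y, h, h'⟩
        obtain ⟨hx, hy⟩ := (hM.opair_iff' h').1 w.2
        exact ⟨⟨x, hx⟩, ⟨y, hy⟩, coe_mem_coe.1 h, hM.opair_iff.1 h'⟩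
      · rintro ⟨x, y, h, h'⟩
        exact ⟨x, y, coe_mem_coe.2 h, hM.opair_iff.2 h'⟩
    obtain ⟨d, hd, hd'⟩ := hM.exists_sep ⟨c, hc⟩
      (P := fun w => ∃ x y, x ε y ∧ w = opair x y) hP
    refine ⟨d, hd, fun w => ?_⟩
    rw [hd', hc']
    constructor
    · rintro ⟨⟨x, hx, y, hy, rfl⟩, x', y', h, h'⟩
      obtain ⟨rfl, rfl⟩ := opair_inj.1 h'
      exact ⟨x, hx, y, hy, h, rfl⟩
    · rintro ⟨x, hx, y, hy, h, rfl⟩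
      exact ⟨⟨x, hx, y, hy, rfl⟩, x, y, h, rfl⟩
  · exact realize_closedUnder hψ _ (fun w a b => w ε a ∧ ¬ w ε b) (by simp) fun a b =>
      hM.exists_sep a (P := fun w => ¬ w ε (b : V)) (P' := fun w => ¬ w ε b)
        fun w => not_congr coe_mem_coe
  · exact realize_closedUnder hψ _ (fun w a b => w ε a ∧ w ε b) (by simp) fun a b =>
      hM.exists_sep a (P := fun w => w ε (b : V)) (P' := fun w => w ε b) fun w => coe_mem_coe
  · refine realize_closedUnder hψ _ (fun w a _ => ∃ x, x ε a ∧ w ε x) (by simp) fun a _ => ?_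
    refine hM.exists_set (sUnion a) (fun w => mem_sUnion) ?_ fun w => ?_
    · rintro w ⟨x, hx, hw⟩
      exact hM.mem_of_mem (hM.mem_of_mem a.2 hx) hw
    · simp only [hM.exists_mem_coe, coe_mem_coe]
  · refine realize_closedUnder hψ _ (fun w a _ => ∃ y, opair w y ε a) (by simp [isApp_iff])
      fun a _ => ?_
    obtain ⟨c, hc, hc'⟩ := hM.exists_dom a
    refine ⟨c, hc, fun w => (hc' w).trans ?_⟩
    constructor
    · rintro ⟨_, hp, y, rfl⟩; exact ⟨y, hp⟩
    · rintro ⟨y, hp⟩; exact ⟨_, hp, y, rfl⟩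
  · refine realize_closedUnder hψ _ (fun w a _ => ∃ x y, w = opair x y ∧ opair y x ε a)
      (by simp [isApp_iff, isOPair_iff]) fun a _ => ?_
    obtain ⟨c, hc, hc'⟩ := hM.exists_converse a
    refine ⟨c, hc, fun w => (hc' w).trans ?_⟩
    constructor
    · rintro ⟨_, hp, x, y, h, rfl⟩; exact ⟨x, y, h, hp⟩
    · rintro ⟨x, y, h, hp⟩; exact ⟨_, hp, x, y, h, rfl⟩
  · refine realize_closedUnder hψ _ (fun w a _ => ∃ x y z, w = opair (opair x y) z ∧
      ∃ p, p ε a ∧ p = opair (opair x z) y) (by simp [isOPair_iff]) fun a _ => ?_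
    obtain ⟨c, hc, hc'⟩ := hM.exists_perm₁ a
    refine ⟨c, hc, fun w => (hc' w).trans ?_⟩
    constructor
    · rintro ⟨p, hp, x, y, z, h, h'⟩; exact ⟨x, y, z, h, p, hp, h'⟩
    · rintro ⟨x, y, z, h, p, hp, h'⟩; exact ⟨p, hp, x, y, z, h, h'⟩
  · refine realize_closedUnder hψ _ (fun w a _ => ∃ x y z, w = opair (opair x y) z ∧
      ∃ p, p ε a ∧ p = opair (opair y z) x) (by simp [isOPair_iff]) fun a _ => ?_
    obtain ⟨c, hc, hc'⟩ := hM.exists_perm₂ a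
    refine ⟨c, hc, fun w => (hc' w).trans ?_⟩
    constructor
    · rintro ⟨p, hp, x, y, z, h, h'⟩; exact ⟨x, y, z, h, p, hp, h'⟩
    · rintro ⟨x, y, z, h, p, hp, h'⟩; exact ⟨p, hp, x, y, z, h, h'⟩

/-- The link between the two notions of class model: the semantic one asks for all of ZFC in `M`,
while uniqueness statements mention only the formula `TM`. -/
theorem IsTransitiveClassModel.realize_TM (hM : IsTransitiveClassModel M)
    (hlim : ∃ w : M, IsLim w) {ψ : LSet.Formula (Fin 2)} {p : V}
    (hψ : ∀ x : V, x ∈ M ↔ ψ.Realize ![x, p]) {φ : LSet.Sentence} (hφ : M ⊨ φ) :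
    (TM ψ φ).Realize ![p] := by
  have hrel {φ : LSet.Sentence} (hφ : M ⊨ φ) :
      Formula.Realize (relativize ψ φ : LSet.Formula (Fin 1)) ![p] := by
    rw [Formula.Realize, Subsingleton.elim default fun i => ((default : Fin 0 → M) i : V)]
    exact (realize_relativize hψ φ default).2 hφ
  unfold TM
  simp only [Formula.realize_inf]
  refine ⟨⟨⟨⟨⟨?_, ?_⟩, hM.realize_goedelClosed hψ⟩, ?_⟩, hrel ?_⟩, hrel hφ⟩
  · simp only [transClass, Formula.Realize, realize_allF, BoundedFormula.realize_imp,
      realize_inClass hψ, val_new, realize_allIn]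
    exact fun x hx z hz => hM.mem_of_mem hx hz
  · simp only [almostUniversal, Formula.Realize, realize_allF, BoundedFormula.realize_imp,
      realize_inClass hψ, val_new, realize_allIn, realize_exF, BoundedFormula.realize_inf,
      realize_subF, val_up]
    exact fun x hx => hM.exists_cover hlim hx
  · simp only [containsOrdinals, Formula.Realize, realize_allF, BoundedFormula.realize_imp,
      realize_inClass hψ, val_new, realize_ordF]
    exact fun x => hM.mem_of_ord
  · exact hM.models.realize_of_mem _ (by simp [ZFC])

end Closure

/-! ### The ultrapower of a class model -/

section Main

variable {V : Type u} [LSet.Structure V] {M : LSet.Substructure V}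

/-- The class of the values of the collapse of the ultrapower of `M`. -/
def ultrapower (M : LSet.Substructure V) [ZFCModel M] (k u : M) : LSet.Substructure V where
  carrier := {x | ∃ f : M, IsFun f k ∧ ((coll k u f : M) : V) = x}
  fun_mem := fun f => nomatch f

theorem mem_ultrapower [ZFCModel M] {k u : M} {x : V} :
    x ∈ ultrapower M k u ↔ ∃ f : M, IsFun f k ∧ ((coll k u f : M) : V) = x := Iff.rfl

/-- Łoś's theorem for a sentence: the condition does not depend on the index, so it holds on a set
in `u` exactly when it holds in `M`. -/
theorem ultrapower_elementarily_equivalent [ZFCModel M] {k u : M} (hm : IsMeasure k u)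
    (φ : LSet.Sentence) : M ⊨ φ ↔ ultrapower M k u ⊨ φ := by
  let π : {f : M // IsFun f k} → ultrapower M k u := fun f => ⟨_, f.1, f.2, rfl⟩
  have hπ (f g) : π f = π g ↔ coll k u f.1 = coll k u g.1 :=
    ⟨fun h => Subtype.ext (congrArg (fun x : ultrapower M k u => (x : V)) h),
      fun h => Subtype.ext (congrArg (fun x : M => (x : V)) h)⟩
  have h := los hm π (fun ⟨_, f, hf, h⟩ => ⟨⟨f, hf⟩, Subtype.ext h⟩)
    (fun f g => (hπ f g).trans (coll_eq_iff hm f.2 g.2))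
    (fun f g => ((coe_mem_coe (x := π f) (y := π g)).symm.trans
      (coe_mem_coe (x := coll k u f.1) (y := coll k u g.1))).trans (coll_mem_iff hm g.2 f.2)) φ default
  have h1 : ultrapower M k u ⊨ φ ↔ BoundedFormula.Realize (M := ultrapower M k u) φ default
    (fun j => π ((default : Fin 0 → _) j)) :=
    iff_of_eq (congrArg (BoundedFormula.Realize (M := ultrapower M k u) φ default)
      (Subsingleton.elim _ _))
  have h2 (i : M) : (BoundedFormula.Realize (M := M) φ default
      fun j => app ((default : Fin 0 → {f : M // IsFun f k}) j).1 i) ↔ M ⊨ φ :=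
    iff_of_eq (congrArg (BoundedFormula.Realize (M := M) φ default) (Subsingleton.elim _ _))
  rw [h1, h]
  simp only [h2]
  exact ⟨fun hφ => Big.of_forall hm fun _ _ => hφ, fun hb => let ⟨_, _, h⟩ := hb.exists hm; h⟩

theorem isUltrapower_ultrapower [ZFCModel M] {k u : M} (hm : IsMeasure k u) :
    IsUltrapower M k u (ultrapower M k u) := by
  have hfun (f : FunctionsOn M k) : IsFun f.1 k := by
    simpa [Formula.Realize] using f.2
  have happ (f : FunctionsOn M k) {i : M} (hi : i ε k) (x : M) : IsApp f.1 i x ↔ x = app f.1 i := by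
    rw [isApp_iff]
    exact ⟨fun h => ((hfun f).app_eq h).symm, fun h => h ▸ (hfun f).app_mem hi⟩
  refine ⟨fun f => (coll k u f.1 : M), ?_, fun f g => ⟨?_, ?_⟩⟩
  · ext x
    constructor
    · rintro ⟨f, rfl⟩; exact ⟨f.1, hfun f, rfl⟩
    · rintro ⟨f, hf, rfl⟩; exact ⟨⟨f, by simpa [Formula.Realize] using hf⟩, rfl⟩
  · rw [Subtype.coe_inj, coll_eq_iff hm (hfun f) (hfun g)]
    simp only [EqMod, Formula.Realize, realize_exIn, realize_allF, BoundedFormula.realize_iff,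
      realize_memF, val_up, val_new, BoundedFormula.realize_inf, realize_exF, realize_appF, val_fv]
    refine exists_congr fun a => and_congr Iff.rfl (forall_congr' fun i => iff_congr Iff.rfl
      (and_congr_right fun hi => ?_))
    simp [happ f hi, happ g hi]
  · refine coe_mem_coe.trans ?_
    rw [coll_mem_iff hm (hfun g) (hfun f)]
    simp only [MemMod, Formula.Realize, realize_exIn, realize_allF, BoundedFormula.realize_iff,
      realize_memF, val_up, val_new, BoundedFormula.realize_inf, realize_exF, realize_appF, val_fv]
    refine exists_congr fun a => and_congr Iff.rfl (forall_congr' fun i => iff_congr Iff.rfl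
      (and_congr_right fun hi => ?_))
    simp [happ f hi, happ g hi, and_assoc]

theorem ultrapower_ne [ZFCModel M] {k u : M} (hm : IsMeasure k u) : ultrapower M k u ≠ M := by
  intro h
  obtain ⟨x, hx⟩ := exists_forall_coll_ne hm
  obtain ⟨f, hf, hfx⟩ := mem_ultrapower.1 (h.symm ▸ x.2 : (x : V) ∈ ultrapower M k u)
  exact hx f hf (Subtype.ext hfx)

variable [ZFCModel V]

theorem isTransitiveClassModel_ultrapower (hM : IsTransitiveClassModel M) [ZFCModel M] {k u : M}
    (hm : IsMeasure k u) : IsTransitiveClassModel (ultrapower M k u) where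
  definable := by
    obtain ⟨p, hp⟩ := hM.def_mem
    -- A class model is defined from a single parameter, so the parameter of `M` is coded together
    -- with `k` and `u`.
    let t : V := opair p (opair k u)
    have ht {n} : DefF {t} (fun _ : Fin n → V => t) := DefF.const_of_mem rfl
    have h1 (n : ℕ) : DefF {t} (fun _ : Fin n → V => p) :=
      DefF.of_graph (R := fun _ y => ∃ z, t = opair y z) fun v y => by
        simp [t, opair_inj, eq_comm]
    have h2 (n : ℕ) : DefF {t} (fun _ : Fin n → V => (k : V)) :=
      DefF.of_graph (R := fun _ y => ∃ x z, t = opair x (opair y z)) fun v y => by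
        simp [t, opair_inj, eq_comm]
    have h3 (n : ℕ) : DefF {t} (fun _ : Fin n → V => (u : V)) :=
      DefF.of_graph (R := fun _ y => ∃ x z, t = opair x (opair z y)) fun v y => by
        simp [t, opair_inj, eq_comm]
    have h4 : Def {t} (fun v : Fin 1 → V => v 0 ∈ M) :=
      (hp {p} rfl).trans fun a ha n => by obtain rfl := ha; exact h1 n
    have hk {n} : DefF {k, u} (fun _ : Fin n → M => k) := DefF.const_of_mem (by simp)
    have hu {n} : DefF {k, u} (fun _ : Fin n → M => u) := DefF.const_of_mem (by simp)
    -- The range of the collapse is defined inside `M` and carried to `V` along the retraction.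
    have h5 : Def {k, u} (fun v : Fin 1 → M => ∃ f, IsFun f k ∧ coll k u f = v 0) := inferInstance
    have h6 := h5.transfer (B := {t}) hM.retract_coe (hM.defF_retract h4) (by
      rintro a (rfl | rfl) n
      · exact h2 n
      · exact h3 n)
    obtain ⟨ψ, hψ⟩ := (Def.and (hP := h4) (hQ := h6)).exists_formula_singleton
    refine ⟨ψ, t, fun x => ((hψ x).trans ?_).symm⟩
    rw [mem_ultrapower]
    constructor
    · rintro ⟨hx, f, hf, h⟩
      refine ⟨f, hf, ?_⟩
      rw [h]
      exact congrArg Subtype.val (hM.retract_coe ⟨x, hx⟩)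
    · rintro ⟨f, hf, rfl⟩
      exact ⟨Subtype.coe_prop _, f, hf, (hM.retract_coe _).symm⟩
  transitive := by
    rintro _ ⟨f, hf, rfl⟩ z hz
    have hz' : z ∈ M := hM.mem_of_mem (Subtype.coe_prop _) hz
    obtain ⟨g, hg, h⟩ := (mem_coll hm).1 (coe_mem_coe.1 hz : (⟨z, hz'⟩ : M) ε coll k u f)
    exact ⟨g, hg.1.1, (congrArg Subtype.val h).symm⟩
  ordinals := by
    intro x hx
    have hx' : Ord x := by simpa [Formula.Realize] using hx
    obtain ⟨f, hf, h⟩ := exists_coll_eq_of_ord hm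
      (hM.ord_coe.1 hx' : Ord (⟨x, hM.mem_of_ord hx'⟩ : M))
    exact ⟨f, hf, congrArg Subtype.val h⟩
  models := ⟨fun φ hφ => (ultrapower_elementarily_equivalent hm φ).1 (realize_of_mem_ZFC hφ)⟩

/-- A uniqueness statement holds in at most one transitive class model with a limit ordinal. -/
theorem IsUniquenessStatement.eq {φ : LSet.Sentence} (hφ : IsUniquenessStatement φ)
    {N : LSet.Substructure V} (hM : IsTransitiveClassModel M) (hN : IsTransitiveClassModel N)
    (hlimM : ∃ w : M, IsLim w) (hlimN : ∃ w : N, IsLim w) (hφM : M ⊨ φ) (hφN : N ⊨ φ) : M = N := by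
  obtain ⟨ψ, p, hψ⟩ := hM.definable
  obtain ⟨ψ', p', hψ'⟩ := hN.definable
  have : V ⊨ ZFC := ZFCModel.models
  -- Uniqueness is a consequence of ZFC, hence true in `V` for the formulas defining the two models.
  have h := (hφ ψ ψ').realize_sentence V
  simp only [uniquenessSentence, Sentence.Realize, Formula.Realize, realize_allF,
    BoundedFormula.realize_imp, BoundedFormula.realize_inf, realize_inst,
    BoundedFormula.realize_iff] at h
  have e1 (χ : LSet.Formula (Fin 1)) (f : Fin 1 → V) (x : V) (hf : f 0 = x) :
      χ.Realize f ↔ χ.Realize ![x] := by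
    rw [show f = ![x] from funext fun i => by fin_cases i; exact hf]
  have e2 (χ : LSet.Formula (Fin 2)) (f : Fin 2 → V) (x y : V) (hf : f 0 = x) (hf' : f 1 = y) :
      χ.Realize f ↔ χ.Realize ![x, y] := by
    rw [show f = ![x, y] from funext fun i => by fin_cases i <;> assumption]
  ext x
  rw [hψ, hψ']
  have := h p p' ⟨(e1 _ _ p (by simp)).2 (hM.realize_TM hlimM hψ hφM),
    (e1 _ _ p' (by simp)).2 (hN.realize_TM hlimN hψ' hφN)⟩ x
  exact (e2 ψ _ x p (by simp) (by simp)).symm.trans (this.trans (e2 ψ' _ x p' (by simp) (by simp)))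

end Main

end CanonicalTruth

theorem mainTheorem2 :
    (∀ T : CanonicalTruth.LSet.Theory, CanonicalTruth.ZFC ⊆ T →
      CanonicalTruth.CanonicallyNecessary.{u} T CanonicalTruth.noMeasurable) ∧
    (∀ (V : Type u) [CanonicalTruth.LSet.Structure V], V ⊨ CanonicalTruth.ZFC →
      ∀ M : CanonicalTruth.LSet.Substructure V, CanonicalTruth.IsTransitiveClassModel M →
      ∀ k U : M, CanonicalTruth.IsMeasureIn M k U →
        ∃ N : CanonicalTruth.LSet.Substructure V,
          CanonicalTruth.IsTransitiveClassModel N ∧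
          CanonicalTruth.IsUltrapower M k U N ∧
          N ≠ M ∧
          ∀ φ : CanonicalTruth.LSet.Sentence, M ⊨ φ ↔ N ⊨ φ) := by
  open CanonicalTruth in
  refine ⟨?_, ?_⟩
  · rintro T - V _ hV M ⟨hM, φ, ⟨hφ, -⟩, hMφ⟩
    have : ZFCModel V := ⟨hV⟩
    have := hM.zfcModel
    by_contra hc
    simp only [noMeasurable, Sentence.Realize, Formula.Realize, BoundedFormula.realize_not,
      not_not, measurableF, realize_exF] at hc
    obtain ⟨k, u, hku⟩ := hc
    have hm : IsMeasure k u := by simpa using (realize_measureF _ _).1 hku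
    have hN := isTransitiveClassModel_ultrapower hM hm
    -- The limit ordinal below the measurable cardinal is absolute and belongs to both models, as
    -- comparing them through `TM` requires.
    obtain ⟨w, hw⟩ := hm.exists_lim
    have hw' := hM.isLim_coe.2 hw
    refine ultrapower_ne hm (hφ.eq hN hM ⟨⟨w, hN.mem_of_ord hw'.1.1⟩, hN.isLim_coe.1 hw'⟩
      ⟨w, hw⟩ ((ultrapower_elementarily_equivalent hm φ).1 hMφ) hMφ)
  · intro V _ hV M hM k u hm
    have : ZFCModel V := ⟨hV⟩
    have := hM.zfcModel
    exact ⟨ultrapower M k u, isTransitiveClassModel_ultrapower hM hm, isUltrapower_ultrapower hm,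
      ultrapower_ne hm, ultrapower_elementarily_equivalent hm⟩
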